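/- For integers $k\ge 1$ and $n\ge 0$, a $k$-colored generalized Frobenius partition of $n$ is a two-rowed array \[\begin{pmatrix} a_1 & a_2 & \cdots & a_r\\ b_1 & b_2 & \cdots & b_r\end{pmatrix},\qquad r\ge 0,\] whose entries are nonnegative integers, each carrying one of $k$ colors, such that each row is strictly decreasing with respect to the order that compares values first and then colors (so the entries of a row are pairwise distinct as colored integers), and such that $n=r+\sum_{i=1}^r a_i+\sum_{i=1}^r b_i$, where the sums are over the values of the entries. Let $c\phi_k(n)$ be the number of these arrays. Theorem. For every integer $n\ge 0$, \[c\phi_6(27n+16)\equiv 0 \pmod{243},\] \[c\phi_6(81n+61)\equiv 0 \pmod{81},\] \[c\phi_6(243n+142)\equiv 0 \pmod{243},\] \[c\phi_6(729n+547)\equiv 0 \pmod{243},\] \[c\phi_6(81n+61)\equiv 3\,c\phi_6(9n+7) \pmod{243}.\] -/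

import Mathlib

/-- A `k`-colored generalized Frobenius partition of `n`: a two-rowed array
`(a₁ > a₂ > ⋯ > a_r ; b₁ > b₂ > ⋯ > b_r)`, `r ≥ 0`, whose entries are nonnegative integers each
carrying one of `k` colors, each row being strictly decreasing for the order that compares
values first and colors second, such that `n = r + ∑ aᵢ + ∑ bᵢ` (the sums being of the values).
A strictly decreasing row is the same thing as the finite set of its entries (value, color). -/
structure ColoredFrobeniusPartition (k n : ℕ) where
  /-- the entries of the top row -/
  top : Finset (ℕ × Fin k)
  /-- the entries of the bottom row -/
  bottom : Finset (ℕ × Fin k)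
  /-- the rows have the same length -/
  card_eq : top.card = bottom.card
  /-- the number being partitioned -/
  weight_eq : top.card + ∑ x ∈ top, x.1 + ∑ x ∈ bottom, x.1 = n

/-- There are only finitely many such arrays, so that counting them with `Nat.card` is sound. -/
instance ColoredFrobeniusPartition.instFinite (k n : ℕ) :
    Finite (ColoredFrobeniusPartition k n) := by
  have key : ∀ s : Finset (ℕ × Fin k), ∑ x ∈ s, x.1 ≤ n →
      s ∈ (Finset.range (n + 1) ×ˢ (Finset.univ : Finset (Fin k))).powerset := by
    intro s hs
    rw [Finset.mem_powerset]
    intro x hx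
    have h := Finset.single_le_sum (f := fun x : ℕ × Fin k => x.1)
      (fun _ _ => Nat.zero_le _) hx
    simp only [Finset.mem_product, Finset.mem_range, Finset.mem_univ, and_true]
    have h2 : x.1 ≤ ∑ x ∈ s, x.1 := h
    omega
  let S := (Finset.range (n + 1) ×ˢ (Finset.univ : Finset (Fin k))).powerset
  let f : ColoredFrobeniusPartition k n → S × S := fun P =>
    (⟨P.top, key _ (by have := P.weight_eq; omega)⟩,
      ⟨P.bottom, key _ (by have := P.weight_eq; omega)⟩)
  refine Finite.of_injective f ?_
  rintro ⟨a, b, _, _⟩ ⟨c, d, _, _⟩ h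
  simp only [f, Prod.mk.injEq, Subtype.mk.injEq] at h
  obtain ⟨rfl, rfl⟩ := h
  rfl

/-- `cphi k n` is the number `cφ_k(n)` of `k`-colored generalized Frobenius partitions of `n`. -/
noncomputable def cphi (k n : ℕ) : ℕ := Nat.card (ColoredFrobeniusPartition k n)

/-!
The constant term in `z` of `∏ (1 + z qⁿ⁺¹)⁶ (1 + z⁻¹ qⁿ)⁶` is the generating function of `cφ₆`: the
exponent of `z` is the difference of the lengths of the rows. By the Jacobi triple product
(`Theta.jacobi_triple_product`) this is `E(q)⁻⁶` times the constant term of `Θ(z)⁶`, where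
`Θ(z) = ∑ zˢ q^(s(s+1)/2)` and `E(q) = ∏ (1 - qⁿ)`. Grouping triples of integers by their sum gives
`Θ(z)³` in terms of the theta series `a(q)` of the hexagonal lattice and `κ(q)` of its nontrivial
coset in the dual lattice (`Theta.theta_cube`), so that
`CΦ₆(q) E(q)⁶ = φ(q³) a(q)² + 2q Ω(q) κ(q)²` with `φ(q) = ∑ q^(n²)`, `Ω(q) = ∑ q^(3n²-2n)`
(`Theta.cphiSeries_mul_euler_pow`).

Everything on the right has a short trisection. The lattice itself gives `a(q) = a(q³) + 2q κ(q³)`.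
Evaluating the formula for `Θ(z)³` at `z = -ω`, with `ω` a third root of unity, gives
`κ(q) = 3 E(q³)³ / E(q)`; its derivative at `z = -1`, together with Jacobi's identity for `E(q)³`,
gives `E(q)³ = E(q³) (a(q³) - q κ(q³))`. Derivatives are taken algebraically, over the dual numbers.
As `κ = 3g` with `g` integral, all expansions in `κ` are finite modulo `243`, and `a ≡ 1` modulo
`3`. Two successive trisections (`Theta.Relations.trisect_c`,
`Theta.Relations.trisect_trisect_c`) and the product formula `Ω(q) E(q) = φ(-q²) ψ(-q³)` then yield
`∑ cφ₆(9n+7) qⁿ ≡ 27 W(q)` modulo `243`, where `W(q) = φ(-q²) ψ(-q³) E(q³)³`.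

The series `W` has no terms of degree `1` modulo `3`, because `φ(-q²)` has none; and the part of
degree `2` modulo `3` of its part of degree `0` modulo `3` is `3 W` again
(`Theta.Relations.trisect_trisect_w`). In terms of the coefficients, `w(3n+1) = 0` and
`w(9n+6) = 3 w(n)`, from which all five congruences are read off.
-/

namespace Theta

open PowerSeries

/-! ### Formal sums of monomials -/

section Sums

variable {R S ι κ : Type*} [CommRing R] [CommRing S]

/-- An exponent function `e : ι → ℤ` is tame if it is nonnegative and takes each value at only
finitely many indices, so that `∑ i, w i * X ^ e i` makes sense as a formal power series. -/
structure Tame (e : ι → ℤ) : Prop where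
  nonneg : ∀ i, 0 ≤ e i
  finite : ∀ n : ℤ, {i | e i ≤ n}.Finite

/-- The formal power series `∑ i, w i * X ^ e i`, meaningful when `e` is tame. Exponents are taken
in `ℤ` so that identities between them can be checked in a ring. -/
noncomputable def qsum (w : ι → R) (e : ι → ℤ) : R⟦X⟧ :=
  mk fun n => ∑ᶠ i, if e i = (n : ℤ) then w i else 0

theorem coeff_qsum (w : ι → R) (e : ι → ℤ) (n : ℕ) (s : Finset ι) (hs : ∀ i, e i = n → i ∈ s) :
    coeff n (qsum w e) = ∑ i ∈ s, if e i = (n : ℤ) then w i else 0 := by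
  rw [qsum, coeff_mk]
  apply finsum_eq_sum_of_support_subset
  intro i hi
  rw [Function.mem_support] at hi
  apply hs
  by_contra h
  simp [h] at hi

/-- Reduction of power series modulo `X ^ n`. -/
noncomputable def modX (R : Type*) [CommRing R] (n : ℕ) :
    R⟦X⟧ →+* R⟦X⟧ ⧸ Ideal.span {(X : R⟦X⟧) ^ n} := Ideal.Quotient.mk _

theorem modX_eq_iff {n : ℕ} {F G : R⟦X⟧} :
    modX R n F = modX R n G ↔ ∀ k < n, coeff k F = coeff k G := by
  rw [modX, Ideal.Quotient.mk_eq_mk_iff_sub_mem, Ideal.mem_span_singleton, X_pow_dvd_iff]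
  simp only [map_sub, sub_eq_zero]

theorem eq_of_modX {F G : R⟦X⟧} (h : ∀ n, modX R n F = modX R n G) : F = G := by
  ext n
  exact modX_eq_iff.1 (h (n + 1)) n (Nat.lt_succ_self n)

theorem modX_eq_zero {n : ℕ} {F : R⟦X⟧} {m : ℕ} (h : n ≤ m) : modX R n (F * X ^ m) = 0 := by
  rw [← map_zero (modX R n), modX_eq_iff]
  intro k hk
  rw [coeff_mul_X_pow', if_neg (by omega), map_zero]

theorem modX_qsum {w : ι → R} {e : ι → ℤ} (he : Tame e) (n : ℕ) (s : Finset ι)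
    (hs : ∀ i, e i < n → i ∈ s) :
    modX R n (qsum w e) = modX R n (∑ i ∈ s, C (w i) * X ^ (e i).toNat) := by
  rw [modX_eq_iff]
  intro k hk
  rw [coeff_qsum w e k s (fun i hi => hs i (by omega)), map_sum]
  refine Finset.sum_congr rfl fun i _ => ?_
  rw [coeff_C_mul, coeff_X_pow]
  have := he.nonneg i
  by_cases h : e i = k
  · rw [if_pos h, if_pos (by omega), mul_one]
  · rw [if_neg h, if_neg (by omega), mul_zero]

theorem Tame.exists_finset {e : ι → ℤ} (he : Tame e) (n : ℤ) :
    ∃ s : Finset ι, ∀ i, e i ≤ n → i ∈ s :=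
  ⟨(he.finite n).toFinset, fun i hi => by simpa using hi⟩

theorem Tame.of_le {e e' : ι → ℤ} (he : Tame e) (h : ∀ i, e i ≤ e' i) : Tame e' :=
  ⟨fun i => (he.nonneg i).trans (h i), fun n => (he.finite n).subset fun i hi => (h i).trans hi⟩

theorem Tame.comp {e : ι → ℤ} (he : Tame e) {f : κ → ι} (hf : Function.Injective f) :
    Tame (fun k => e (f k)) :=
  ⟨fun _ => he.nonneg _, fun n => Set.Finite.preimage (f := f) hf.injOn (he.finite n)⟩

theorem Tame.prod {e : ι → ℤ} {e' : κ → ℤ} (he : Tame e) (he' : Tame e') :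
    Tame (fun p : ι × κ => e p.1 + e' p.2) where
  nonneg p := add_nonneg (he.nonneg _) (he'.nonneg _)
  finite n := ((he.finite n).prod (he'.finite n)).subset fun p hp => by
    have h1 := he.nonneg p.1
    have h2 := he'.nonneg p.2
    simp only [Set.mem_ofPred_eq] at hp
    exact ⟨show e p.1 ≤ n by omega, show e' p.2 ≤ n by omega⟩

theorem Tame.mul_left {e : ι → ℤ} (he : Tame e) {k : ℤ} (hk : 1 ≤ k) :
    Tame (fun i => k * e i) :=
  he.of_le fun i => by nlinarith [he.nonneg i]

theorem Tame.add_const {e : ι → ℤ} (he : Tame e) {k : ℤ} (hk : 0 ≤ k) :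
    Tame (fun i => e i + k) :=
  he.of_le fun i => by linarith

theorem qsum_congr {w w' : ι → R} {e e' : ι → ℤ} (hw : ∀ i, w i = w' i) (he : ∀ i, e i = e' i) :
    qsum w e = qsum w' e' := by
  rw [funext hw, funext he]

/-- Terms of weight zero may be dropped: the sum is unchanged by restricting to (and reindexing)
a set of indices that carries all the weights. -/
theorem qsum_comp_injective {w : ι → R} {e : ι → ℤ} {f : κ → ι} (hf : Function.Injective f)
    (h0 : ∀ i, i ∉ Set.range f → w i = 0) :
    qsum w e = qsum (fun k => w (f k)) (fun k => e (f k)) := by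
  ext n
  simp only [qsum, coeff_mk]
  rw [← finsum_mem_range (f := fun i => if e i = (n : ℤ) then w i else 0) hf]
  refine finsum_congr fun i => ?_
  by_cases hi : i ∈ Set.range f
  · simp [hi]
  · rw [h0 i hi]; simp

theorem qsum_equiv (w : ι → R) (e : ι → ℤ) (f : κ ≃ ι) :
    qsum w e = qsum (fun k => w (f k)) (fun k => e (f k)) :=
  qsum_comp_injective f.injective fun i hi => absurd (f.surjective i) hi

theorem qsum_add (w w' : ι → R) {e : ι → ℤ} (he : Tame e) :
    qsum w e + qsum w' e = qsum (fun i => w i + w' i) e := by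
  ext n
  obtain ⟨s, hs⟩ := he.exists_finset n
  rw [map_add, coeff_qsum w e n s fun i hi => hs i hi.le,
    coeff_qsum w' e n s fun i hi => hs i hi.le,
    coeff_qsum _ e n s fun i hi => hs i hi.le, ← Finset.sum_add_distrib]
  refine Finset.sum_congr rfl fun i _ => ?_
  split_ifs <;> simp

/-- Additive functionals act on the weights. -/
theorem coeff_qsum_map (f : R →+ S) (w : ι → R) {e : ι → ℤ} (he : Tame e) (n : ℕ) :
    f (coeff n (qsum w e)) = coeff n (qsum (fun i => f (w i)) e) := by
  obtain ⟨s, hs⟩ := he.exists_finset n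
  rw [coeff_qsum w e n s fun i hi => hs i hi.le, coeff_qsum _ e n s fun i hi => hs i hi.le, map_sum]
  refine Finset.sum_congr rfl fun i _ => ?_
  split_ifs <;> simp

theorem map_qsum (f : R →+* S) (w : ι → R) {e : ι → ℤ} (he : Tame e) :
    map f (qsum w e) = qsum (fun i => f (w i)) e := by
  ext n
  rw [coeff_map]
  exact coeff_qsum_map f.toAddMonoidHom w he n

theorem C_mul_qsum (c : R) (w : ι → R) {e : ι → ℤ} (he : Tame e) :
    C c * qsum w e = qsum (fun i => c * w i) e := by
  ext n
  rw [coeff_C_mul]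
  exact coeff_qsum_map (AddMonoidHom.mulLeft c) w he n

theorem neg_qsum (w : ι → R) {e : ι → ℤ} (he : Tame e) :
    -qsum w e = qsum (fun i => -w i) e := by
  have := C_mul_qsum (-1) w he
  simpa using this

theorem X_pow_mul_qsum (k : ℕ) (w : ι → R) {e : ι → ℤ} (he : Tame e) :
    X ^ k * qsum w e = qsum w (fun i => e i + k) := by
  ext n
  rw [coeff_X_pow_mul']
  split_ifs with h
  · simp only [qsum, coeff_mk]
    refine finsum_congr fun i => ?_
    congr 1
    simp only [eq_iff_iff]
    omega
  · simp only [qsum, coeff_mk]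
    symm
    rw [finsum_eq_zero_of_forall_eq_zero]
    intro i
    have := he.nonneg i
    rw [if_neg (by omega)]

theorem X_mul_qsum (w : ι → R) {e : ι → ℤ} (he : Tame e) :
    X * qsum w e = qsum w (fun i => e i + 1) := by
  simpa using X_pow_mul_qsum 1 w he

theorem expand_qsum (k : ℕ) (hk : k ≠ 0) (w : ι → R) (e : ι → ℤ) :
    expand k hk (qsum w e) = qsum w (fun i => k * e i) := by
  have hk' : (k : ℤ) ≠ 0 := by exact_mod_cast hk
  ext n
  rw [coeff_expand]
  split_ifs with h
  · obtain ⟨m, rfl⟩ := h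
    rw [Nat.mul_div_cancel_left _ (Nat.pos_of_ne_zero hk)]
    simp only [qsum, coeff_mk]
    refine finsum_congr fun i => ?_
    congr 1
    push_cast
    rw [mul_right_inj' hk']
  · simp only [qsum, coeff_mk]
    symm
    rw [finsum_eq_zero_of_forall_eq_zero]
    intro i
    rw [if_neg]
    intro h'
    exact h (by exact_mod_cast (Dvd.intro _ h' : (k : ℤ) ∣ n))

theorem qsum_mul {w : ι → R} {w' : κ → R} {e : ι → ℤ} {e' : κ → ℤ} (he : Tame e) (he' : Tame e') :
    qsum w e * qsum w' e' = qsum (fun p : ι × κ => w p.1 * w' p.2) (fun p => e p.1 + e' p.2) := by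
  refine eq_of_modX fun n => ?_
  obtain ⟨s, hs⟩ := he.exists_finset n
  obtain ⟨t, ht⟩ := he'.exists_finset n
  rw [map_mul, modX_qsum he n s fun i hi => hs i hi.le, modX_qsum he' n t fun i hi => ht i hi.le,
    modX_qsum (he.prod he') n (s ×ˢ t), ← map_mul, Finset.sum_mul_sum, ← Finset.sum_product']
  · congr 1
    refine Finset.sum_congr rfl fun p _ => ?_
    rw [Int.toNat_add (he.nonneg _) (he'.nonneg _), pow_add, map_mul]
    ring
  · intro p hp
    have h1 := he.nonneg p.1
    have h2 := he'.nonneg p.2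
    exact Finset.mem_product.2 ⟨hs _ (by omega), ht _ (by omega)⟩

theorem qsum_sum_type {w : ι ⊕ κ → R} {e : ι ⊕ κ → ℤ} (he : Tame e) :
    qsum w e = qsum (fun i => w (.inl i)) (fun i => e (.inl i)) +
      qsum (fun i => w (.inr i)) (fun i => e (.inr i)) := by
  ext n
  obtain ⟨s, hs⟩ := (he.comp Sum.inl_injective).exists_finset n
  obtain ⟨t, ht⟩ := (he.comp Sum.inr_injective).exists_finset n
  rw [map_add, coeff_qsum _ _ n s fun i hi => hs i hi.le, coeff_qsum _ _ n t fun i hi => ht i hi.le,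
    coeff_qsum w e n (s.disjSum t), Finset.sum_disjSum]
  rintro (i | i) hi
  · simpa using hs i hi.le
  · simpa using ht i hi.le

/-- Splitting a sum into three parts, along three maps that jointly enumerate the index set. -/
theorem qsum_trisect {w : ι → R} {e : ι → ℤ} (he : Tame e) (f g h : κ → ι)
    (hbij : Function.Bijective (Sum.elim f (Sum.elim g h))) :
    qsum w e = qsum (fun k => w (f k)) (fun k => e (f k)) +
      (qsum (fun k => w (g k)) (fun k => e (g k)) +
        qsum (fun k => w (h k)) (fun k => e (h k))) := by
  have h1 : Tame fun k => e (Sum.elim f (Sum.elim g h) k) := he.comp hbij.1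
  rw [qsum_equiv w e (Equiv.ofBijective _ hbij)]
  simp only [Equiv.ofBijective_apply]
  rw [qsum_sum_type h1, qsum_sum_type (h1.comp Sum.inr_injective)]
  rfl

theorem trisect_bijective {f g h : κ → ι} (hf : Function.Injective f) (hg : Function.Injective g)
    (hh : Function.Injective h) (hfg : ∀ i j, f i ≠ g j) (hfh : ∀ i j, f i ≠ h j)
    (hgh : ∀ i j, g i ≠ h j) (hs : ∀ i, (∃ k, f k = i) ∨ (∃ k, g k = i) ∨ ∃ k, h k = i) :
    Function.Bijective (Sum.elim f (Sum.elim g h)) := by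
  constructor
  · refine hf.sumElim (hg.sumElim hh hgh) ?_
    rintro a (b | b)
    · exact hfg a b
    · exact hfh a b
  · intro i
    rcases hs i with ⟨k, hk⟩ | ⟨k, hk⟩ | ⟨k, hk⟩
    · exact ⟨.inl k, hk⟩
    · exact ⟨.inr (.inl k), hk⟩
    · exact ⟨.inr (.inr k), hk⟩

end Sums

/-! ### Infinite products -/

section Products

variable {R S ι κ : Type*} [CommRing R] [CommRing S]

theorem Tame.finset {e : ι → ℕ} (he : Tame fun i => (e i : ℤ)) :
    Tame fun A : Finset ι => ((∑ i ∈ A, e i : ℕ) : ℤ) where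
  nonneg A := by positivity
  finite n := by
    obtain ⟨s, hs⟩ := he.exists_finset n
    refine (s.powerset.finite_toSet).subset fun A hA => ?_
    simp only [Set.mem_ofPred_eq] at hA
    simp only [Finset.coe_powerset, Set.mem_preimage, Set.mem_powerset_iff, Finset.coe_subset]
    intro i hi
    have := Finset.single_le_sum (f := e) (fun _ _ => Nat.zero_le _) hi
    exact hs i (by omega)

/-- The infinite product `∏ i, (1 + c i * X ^ e i)`, written out as a sum over the finite sets of
indices. -/
noncomputable def qprod (c : ι → R) (e : ι → ℕ) : R⟦X⟧ :=
  qsum (fun A : Finset ι => ∏ i ∈ A, c i) (fun A => ((∑ i ∈ A, e i : ℕ) : ℤ))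

theorem modX_qprod {c : ι → R} {e : ι → ℕ} (he : Tame fun i => (e i : ℤ)) (n : ℕ) (s : Finset ι)
    (hs : ∀ i, e i < n → i ∈ s) :
    modX R n (qprod c e) = modX R n (∏ i ∈ s, (1 + C (c i) * X ^ e i)) := by
  rw [qprod, modX_qsum he.finset n s.powerset, Finset.prod_one_add]
  · congr 1
    refine Finset.sum_congr rfl fun A _ => ?_
    rw [Finset.prod_mul_distrib, Finset.prod_pow_eq_pow_sum, map_prod, Int.toNat_natCast]
  · intro A hA
    rw [Finset.mem_powerset]
    intro i hi
    have := Finset.single_le_sum (f := e) (fun _ _ => Nat.zero_le _) hi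
    exact hs i (by omega)

theorem map_qprod (f : R →+* S) (c : ι → R) {e : ι → ℕ} (he : Tame fun i => (e i : ℤ)) :
    map f (qprod c e) = qprod (fun i => f (c i)) e := by
  rw [qprod, map_qsum f _ he.finset]
  simp only [map_prod, qprod]

theorem expand_qprod (k : ℕ) (hk : k ≠ 0) (c : ι → R) (e : ι → ℕ) :
    expand k hk (qprod c e) = qprod c (fun i => k * e i) := by
  rw [qprod, expand_qsum, qprod]
  refine qsum_congr (fun _ => rfl) fun A => ?_
  rw [← Finset.mul_sum]
  push_cast
  rfl

theorem qprod_equiv (c : ι → R) {e : ι → ℕ} (f : κ ≃ ι) :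
    qprod c e = qprod (fun k => c (f k)) (fun k => e (f k)) := by
  rw [qprod, qsum_equiv _ _ f.finsetCongr, qprod]
  refine qsum_congr (fun A => ?_) fun A => ?_ <;> simp [Finset.sum_map]

theorem qprod_sum_type {c : ι ⊕ κ → R} {e : ι ⊕ κ → ℕ} (he : Tame fun i => (e i : ℤ)) :
    qprod c e = qprod (fun i => c (.inl i)) (fun i => e (.inl i)) *
      qprod (fun i => c (.inr i)) (fun i => e (.inr i)) := by
  have h1 := he.comp Sum.inl_injective
  have h2 := he.comp Sum.inr_injective
  refine eq_of_modX fun n => ?_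
  obtain ⟨s, hs⟩ := h1.exists_finset n
  obtain ⟨t, ht⟩ := h2.exists_finset n
  rw [map_mul, modX_qprod h1 n s (fun i hi => hs i (by omega)),
    modX_qprod h2 n t (fun i hi => ht i (by omega)), modX_qprod he n (s.disjSum t),
    Finset.prod_disjSum, map_mul]
  rintro (i | i) hi
  · simpa using hs i (by omega)
  · simpa using ht i (by omega)

/-- `∏ (1 + c xᵉ) * ∏ (1 - c xᵉ) = ∏ (1 - c² x²ᵉ)`. -/
theorem qprod_mul_qprod_neg (c : ι → R) {e : ι → ℕ} (he : Tame fun i => (e i : ℤ)) :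
    qprod c e * qprod (fun i => -c i) e = qprod (fun i => -c i ^ 2) (fun i => 2 * e i) := by
  refine eq_of_modX fun n => ?_
  obtain ⟨s, hs⟩ := he.exists_finset n
  rw [map_mul, modX_qprod he n s (fun i hi => hs i (by omega)),
    modX_qprod he n s (fun i hi => hs i (by omega)), modX_qprod (he.of_le ?_) n s, ← map_mul,
    ← Finset.prod_mul_distrib]
  · congr 1
    refine Finset.prod_congr rfl fun i _ => ?_
    simp only [map_neg, map_pow]
    ring
  · intro i hi
    exact hs i (by omega)
  · intro i
    push_cast
    omega

/-- `∏ (1 - xᵉ) (1 - ω xᵉ) (1 - ω² xᵉ) = ∏ (1 - x³ᵉ)` for `ω² + ω + 1 = 0`. -/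
theorem qprod_mul_qprod_mul_qprod {w : R} (hw : w ^ 2 + w + 1 = 0) {e : ι → ℕ}
    (he : Tame fun i => (e i : ℤ)) :
    qprod (fun _ => -w) e * qprod (fun _ => -w ^ 2) e * qprod (fun _ => (-1 : R)) e =
      qprod (fun _ => (-1 : R)) (fun i => 3 * e i) := by
  have hw3 : (C w : R⟦X⟧) ^ 2 + C w + 1 = 0 := by
    simpa using congrArg (C : R →+* R⟦X⟧) hw
  refine eq_of_modX fun n => ?_
  obtain ⟨s, hs⟩ := he.exists_finset n
  rw [map_mul, map_mul, modX_qprod he n s (fun i hi => hs i (by omega)),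
    modX_qprod he n s (fun i hi => hs i (by omega)),
    modX_qprod he n s (fun i hi => hs i (by omega)), modX_qprod (he.of_le ?_) n s, ← map_mul,
    ← map_mul, ← Finset.prod_mul_distrib, ← Finset.prod_mul_distrib]
  · congr 1
    refine Finset.prod_congr rfl fun i _ => ?_
    simp only [map_neg, map_pow, map_one]
    generalize (C w : R⟦X⟧) = v at *
    rw [mul_comm 3 (e i), pow_mul]
    generalize (X : R⟦X⟧) ^ e i = x
    linear_combination (-x + x ^ 2 + (v - 1) * (x ^ 2 - x ^ 3)) * hw3
  · intro i hi
    exact hs i (by omega)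
  · intro i
    push_cast
    omega

/-- The product over `ι × Fin k` of factors that do not depend on the second index is a `k`-th
power. -/
theorem qprod_prod_fin (k : ℕ) (c : ι → R) {e : ι → ℕ} (he : Tame fun i => (e i : ℤ)) :
    qprod (fun p : ι × Fin k => c p.1) (fun p => e p.1) = qprod c e ^ k := by
  have h2 : Tame fun p : ι × Fin k => (e p.1 : ℤ) :=
    ⟨fun p => he.nonneg _, fun n => ((he.finite n).prod Set.finite_univ).subset
      fun p hp => ⟨hp, Set.mem_univ _⟩⟩
  refine eq_of_modX fun n => ?_
  obtain ⟨s, hs⟩ := he.exists_finset n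
  rw [map_pow, modX_qprod he n s (fun i hi => hs i (by omega)),
    modX_qprod h2 n (s ×ˢ Finset.univ), Finset.prod_product, ← map_pow, ← Finset.prod_pow]
  · simp
  · intro p hp
    simpa using hs p.1 (by omega)

end Products

/-! ### The Jacobi triple product -/

section GaussianBinomial

variable {A : Type*} [CommRing A]

/-- The Gaussian binomial coefficient `[m + n choose m]` at `q`. -/
def gaussBinom (q : A) : ℕ → ℕ → A
  | 0, _ => 1
  | _ + 1, 0 => 1
  | m + 1, n + 1 => gaussBinom q m (n + 1) + q ^ (m + 1) * gaussBinom q (m + 1) n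

theorem gaussBinom_zero_right (q : A) (m : ℕ) : gaussBinom q m 0 = 1 := by
  cases m <;> rw [gaussBinom]

theorem gaussBinom_zero_left (q : A) (n : ℕ) : gaussBinom q 0 n = 1 := by
  rw [gaussBinom]

theorem prod_mul_prod_mul_gaussBinom (q : A) : ∀ m n : ℕ,
    (∏ i ∈ Finset.range m, (1 - q ^ (i + 1))) * (∏ i ∈ Finset.range n, (1 - q ^ (i + 1))) *
      gaussBinom q m n = ∏ i ∈ Finset.range (m + n), (1 - q ^ (i + 1))
  | 0, n => by simp [gaussBinom_zero_left]
  | m + 1, 0 => by simp [gaussBinom_zero_right]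
  | m + 1, n + 1 => by
    have h1 := prod_mul_prod_mul_gaussBinom q m (n + 1)
    have h2 := prod_mul_prod_mul_gaussBinom q (m + 1) n
    rw [gaussBinom, show m + 1 + (n + 1) = m + n + 1 + 1 by ring,
      Finset.prod_range_succ _ (m + n + 1), Finset.prod_range_succ _ m]
    rw [show m + (n + 1) = m + n + 1 by ring] at h1
    rw [show m + 1 + n = m + n + 1 by ring, Finset.prod_range_succ _ m] at h2
    rw [Finset.prod_range_succ _ n] at h1 ⊢
    linear_combination (1 - q ^ (m + 1)) * h1 + q ^ (m + 1) * (1 - q ^ (n + 1)) * h2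

/-- The finite `q`-binomial theorem, in homogeneous form. -/
theorem prod_add_mul_pow (q x y : A) (K : ℕ) :
    ∏ i ∈ Finset.range K, (y + x * q ^ i) =
      ∑ p ∈ Finset.HasAntidiagonal.antidiagonal K,
        q ^ (p.2.choose 2) * gaussBinom q p.1 p.2 * x ^ p.2 * y ^ p.1 := by
  induction K with
  | zero => simp [gaussBinom_zero_left]
  | succ K ih =>
    have hsplit : ∀ p ∈ Finset.HasAntidiagonal.antidiagonal (K + 1),
        q ^ (p.2.choose 2) * gaussBinom q p.1 p.2 * x ^ p.2 * y ^ p.1 =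
        (if p.1 = 0 then 0 else
          q ^ (p.2.choose 2) * gaussBinom q (p.1 - 1) p.2 * x ^ p.2 * y ^ p.1) +
        (if p.2 = 0 then 0 else
          q ^ (p.2.choose 2) * (q ^ p.1 * gaussBinom q p.1 (p.2 - 1)) * x ^ p.2 * y ^ p.1) := by
      rintro ⟨m, n⟩ hp
      rw [Finset.HasAntidiagonal.mem_antidiagonal] at hp
      rcases m with _ | m <;> rcases n with _ | n
      · simp at hp
      · simp [gaussBinom_zero_left]
      · simp [gaussBinom_zero_right]
      · simp only [Nat.succ_ne_zero, if_false, Nat.add_sub_cancel, gaussBinom]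
        ring
    rw [Finset.sum_congr rfl hsplit, Finset.sum_add_distrib, Finset.Nat.sum_antidiagonal_succ,
      Finset.Nat.sum_antidiagonal_succ', Finset.prod_range_succ, ih, mul_add, Finset.sum_mul,
      Finset.sum_mul]
    simp only [if_true, zero_add, Nat.succ_ne_zero, if_false, Nat.add_sub_cancel]
    congr 1
    · exact Finset.sum_congr rfl fun p _ => by ring
    · refine Finset.sum_congr rfl fun p hp => ?_
      rw [← Finset.HasAntidiagonal.mem_antidiagonal.1 hp, Nat.choose_succ_succ' p.2 1,
        Nat.choose_one_right]
      ring

end GaussianBinomial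

/-- Triangular numbers, for integer index. -/
def tri (s : ℤ) : ℤ := s * (s + 1) / 2

theorem two_mul_tri (s : ℤ) : 2 * tri s = s * (s + 1) :=
  Int.mul_ediv_cancel' (Int.even_mul_succ_self s).two_dvd

theorem tri_nonneg (s : ℤ) : 0 ≤ tri s := by
  have := two_mul_tri s
  rcases le_or_gt 0 s with h | h <;> nlinarith

theorem tri_pred (s : ℤ) : tri (s - 1) = tri s - s := by
  linarith [two_mul_tri s, two_mul_tri (s - 1)]

theorem tame_of_sq_le {e : ℤ → ℤ} (h0 : ∀ s, 0 ≤ e s) (h : ∀ s, s ^ 2 ≤ 4 * e s + 4) : Tame e where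
  nonneg := h0
  finite n := (Set.finite_Icc (-(4 * n + 4)) (4 * n + 4)).subset fun s hs => by
    have h1 : e s ≤ n := hs
    have h2 := h s
    constructor <;> nlinarith

theorem tame_of_sq_add_sq_le {e : ℤ × ℤ → ℤ} (h0 : ∀ s, 0 ≤ e s)
    (h : ∀ s, s.1 ^ 2 + s.2 ^ 2 ≤ 4 * e s + 4) : Tame e where
  nonneg := h0
  finite n := ((Set.finite_Icc (-(4 * n + 4)) (4 * n + 4)).prod
      (Set.finite_Icc (-(4 * n + 4)) (4 * n + 4))).subset fun s hs => by
    have h1 : e s ≤ n := hs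
    have h2 := h s
    constructor <;> constructor <;> nlinarith [sq_nonneg s.1, sq_nonneg s.2]

theorem tame_tri : Tame tri :=
  tame_of_sq_le tri_nonneg fun s => by nlinarith [two_mul_tri s, sq_nonneg (s + 1)]

theorem theta_exponent_nonneg (α β : ℕ) (s : ℤ) : 0 ≤ α * tri s + β * tri (s - 1) :=
  add_nonneg (mul_nonneg (by positivity) (tri_nonneg _)) (mul_nonneg (by positivity) (tri_nonneg _))

theorem sq_le_theta_exponent {α β : ℕ} (h : 1 ≤ α + β) (s : ℤ) :
    s ^ 2 ≤ 4 * (α * tri s + β * tri (s - 1)) + 4 := by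
  have h1 := two_mul_tri s
  have h2 := two_mul_tri (s - 1)
  have h3 := tri_nonneg s
  have h4 := tri_nonneg (s - 1)
  rcases Nat.eq_zero_or_pos α with h0 | h0
  · have hb : (1 : ℤ) ≤ β := by omega
    rw [h0]
    push_cast
    nlinarith [mul_nonneg (sub_nonneg.2 hb) h4, sq_nonneg (s - 1)]
  · have hb : (1 : ℤ) ≤ α := by omega
    have hc : (0 : ℤ) ≤ β := by positivity
    nlinarith [mul_nonneg (sub_nonneg.2 hb) h3, mul_nonneg hc h4, sq_nonneg (s + 1)]

theorem tame_theta {α β : ℕ} (h : 1 ≤ α + β) : Tame fun s => α * tri s + β * tri (s - 1) :=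
  tame_of_sq_le (theta_exponent_nonneg α β) (sq_le_theta_exponent h)

section TripleProduct

variable {R S : Type*} [CommRing R] [CommRing S]

/-- The theta series `∑ s, u ^ s * X ^ (α s (s + 1) / 2 + β s (s - 1) / 2)` over `s : ℤ`. -/
noncomputable def theta (u : Rˣ) (α β : ℕ) : R⟦X⟧ :=
  qsum (fun s : ℤ => ((u ^ s : Rˣ) : R)) (fun s => α * tri s + β * tri (s - 1))

theorem tame_progression (r : ℕ) {k : ℕ} (hk : 1 ≤ k) :
    Tame fun i : ℕ => ((r + k * i : ℕ) : ℤ) where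
  nonneg i := by positivity
  finite n := (Set.finite_Iic n.toNat).subset fun i hi => by
    have h1 : ((r + k * i : ℕ) : ℤ) ≤ n := hi
    have h2 : i ≤ k * i := Nat.le_mul_of_pos_left i hk
    rw [Set.mem_Iic]
    omega

/-- The infinite product `∏ i, (1 + c * X ^ (r + k * i))` over `i : ℕ`. -/
noncomputable def progProd (c : R) (r k : ℕ) : R⟦X⟧ := qprod (fun _ : ℕ => c) (fun i => r + k * i)

theorem modX_progProd (c : R) (r : ℕ) {k : ℕ} (hk : 1 ≤ k) {n N : ℕ} (hN : n ≤ N) :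
    modX R n (progProd c r k) = modX R n (∏ i ∈ Finset.range N, (1 + C c * X ^ (r + k * i))) := by
  refine modX_qprod (tame_progression r hk) n _ fun i hi => ?_
  have h2 : i ≤ k * i := Nat.le_mul_of_pos_left i hk
  rw [Finset.mem_range]
  omega

theorem constantCoeff_progProd (c : R) {r k : ℕ} (hr : 1 ≤ r) (hk : 1 ≤ k) :
    constantCoeff (progProd c r k) = 1 := by
  have h := modX_qprod (c := fun _ => c) (tame_progression r hk) 1 ∅ fun i hi => by omega
  rw [Finset.prod_empty, modX_eq_iff] at h
  simpa [progProd] using h 0 zero_lt_one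

theorem isUnit_progProd (c : R) {r k : ℕ} (hr : 1 ≤ r) (hk : 1 ≤ k) :
    IsUnit (progProd c r k) := by
  rw [isUnit_iff_constantCoeff, constantCoeff_progProd c hr hk]
  exact isUnit_one

theorem map_progProd (f : R →+* S) (c : R) (r : ℕ) {k : ℕ} (hk : 1 ≤ k) :
    map f (progProd c r k) = progProd (f c) r k :=
  map_qprod f _ (tame_progression r hk)

theorem expand_progProd (m : ℕ) (hm : m ≠ 0) (c : R) (r k : ℕ) :
    expand m hm (progProd c r k) = progProd c (m * r) (m * k) := by
  rw [progProd, expand_qprod, progProd]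
  congr 1
  funext i
  ring

/-- Gaussian binomial coefficients with both indices large are inverse to `∏ (1 - q ^ i)`. -/
theorem modX_progProd_mul_gaussBinom {k : ℕ} (hk : 1 ≤ k) {n a b : ℕ} (ha : n ≤ a) (hb : n ≤ b) :
    modX R n (progProd (-1) k k * gaussBinom (X ^ k) a b) = 1 := by
  have hE : IsUnit (modX R n (progProd (-1 : R) k k)) := (isUnit_progProd _ hk hk).map _
  have key : ∀ N, n ≤ N → modX R n (progProd (-1) k k) =
      modX R n (∏ i ∈ Finset.range N, (1 - (X ^ k) ^ (i + 1))) := fun N hN => by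
    rw [modX_progProd _ _ hk hN]
    congr 1
    refine Finset.prod_congr rfl fun i _ => ?_
    rw [← pow_mul, map_neg, map_one]
    ring
  have h := congrArg (modX R n) (prod_mul_prod_mul_gaussBinom (X ^ k : R⟦X⟧) a b)
  rw [map_mul, map_mul, ← key a ha, ← key b hb, ← key (a + b) (by omega)] at h
  rw [map_mul]
  exact hE.mul_left_cancel (by rw [mul_one, ← mul_assoc, h])

theorem prod_mul_prod_eq_sum_gaussBinom (u : Rˣ) {α β k : ℕ} (hk : α + β = k) (N : ℕ) :
    (∏ i ∈ Finset.range N, (1 + C (u : R) * X ^ (α + k * i))) *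
      (∏ i ∈ Finset.range N, (1 + C ((u⁻¹ : Rˣ) : R) * X ^ (β + k * i))) =
    ∑ p ∈ Finset.HasAntidiagonal.antidiagonal (2 * N), C ((u ^ ((p.2 : ℤ) - N) : Rˣ) : R) *
      X ^ ((α * tri ((p.2 : ℤ) - N) + β * tri ((p.2 : ℤ) - N - 1)).toNat) *
      gaussBinom (X ^ k) p.1 p.2 := by
  have h := prod_add_mul_pow (X ^ k : R⟦X⟧) (C (u : R) * X ^ α) (X ^ (k * N)) (2 * N)
  have hu : (C (u : R) : R⟦X⟧) * C ((u⁻¹ : Rˣ) : R) = 1 := by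
    rw [← map_mul, Units.mul_inv, map_one]
  -- With `Q = X ^ k`, `y = X ^ (k N)`, `x = u X ^ α`, the upper half of the factors `y + x Q ^ i` is
  -- the product over `u`, and the lower half that over `u⁻¹`, up to monomials.
  have hlow : ∏ i ∈ Finset.range N, ((X : R⟦X⟧) ^ (k * N) + C (u : R) * X ^ α * (X ^ k) ^ i) =
      C (u : R) ^ N * X ^ (∑ i ∈ Finset.range N, (α + k * i)) *
        ∏ i ∈ Finset.range N, (1 + C ((u⁻¹ : Rˣ) : R) * X ^ (β + k * i)) := by
    rw [← Finset.prod_range_reflect (fun i => 1 + C ((u⁻¹ : Rˣ) : R) * X ^ (β + k * i)),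
      ← Finset.prod_pow_eq_pow_sum, ← Finset.card_range N, ← Finset.prod_const, Finset.card_range,
      ← Finset.prod_mul_distrib, ← Finset.prod_mul_distrib]
    refine Finset.prod_congr rfl fun i hi => ?_
    obtain ⟨d, rfl⟩ : ∃ d, N = i + 1 + d :=
      ⟨N - (i + 1), by rw [Finset.mem_range] at hi; omega⟩
    have e1 : k * (i + 1 + d) = (α + k * i) + (β + k * (i + 1 + d - 1 - i)) := by
      rw [show i + 1 + d - 1 - i = d by omega, ← hk]
      ring
    rw [e1, pow_add, ← pow_mul, mul_assoc, ← pow_add X α]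
    linear_combination (-X ^ (α + k * i) * X ^ (β + k * (i + 1 + d - 1 - i))) * hu
  have hhigh : ∏ i ∈ Finset.range N,
      ((X : R⟦X⟧) ^ (k * N) + C (u : R) * X ^ α * (X ^ k) ^ (N + i)) =
      X ^ (k * N * N) * ∏ i ∈ Finset.range N, (1 + C (u : R) * X ^ (α + k * i)) := by
    rw [pow_mul X (k * N) N]
    conv_rhs => rw [← Finset.card_range N, ← Finset.prod_const, Finset.card_range]
    rw [← Finset.prod_mul_distrib]
    refine Finset.prod_congr rfl fun i hi => ?_
    ring
  rw [two_mul, Finset.prod_range_add, hlow, hhigh] at h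
  -- The common factor to be cancelled: a power of `X` times a power of the unit `u`.
  have hreg : IsLeftRegular ((C (u : R) ^ N * X ^ (∑ i ∈ Finset.range N, (α + k * i) + k * N * N)) :
      R⟦X⟧) := by
    refine IsLeftRegular.mul ?_ ?_
    · exact ((u.isUnit.map C).pow N).isRegular.left
    · intro F G hFG
      exact X_pow_mul_cancel hFG
  apply hreg
  simp only
  have hsum : ((∑ i ∈ Finset.range N, (α + k * i) : ℕ) : ℤ) = α * N + k * tri (N - 1) := by
    clear h hlow hhigh hreg
    induction N with
    | zero => simp [tri]
    | succ N ih =>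
      rw [Finset.sum_range_succ, Nat.cast_add, ih]
      push_cast
      have h1 := two_mul_tri ((N : ℤ) - 1)
      rw [show (N : ℤ) + 1 - 1 = N by ring, tri_pred]
      ring
  rw [two_mul, pow_add, Finset.mul_sum]
  calc _ = _ := by ring
    _ = _ := h
    _ = _ := by
      refine Finset.sum_congr rfl fun p hp => ?_
      rw [Finset.HasAntidiagonal.mem_antidiagonal] at hp
      have hpN : (p.1 : ℤ) + p.2 = N + N := by exact_mod_cast hp
      have hpow : (C (u : R) : R⟦X⟧) ^ p.2 =
          C (u : R) ^ N * C ((u ^ ((p.2 : ℤ) - N) : Rˣ) : R) := by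
        rw [← map_pow, ← map_pow, ← map_mul, ← Units.val_pow_eq_pow_val, ← Units.val_pow_eq_pow_val,
          ← Units.val_mul, ← zpow_natCast, ← zpow_natCast, ← zpow_add]
        congr 4
        ring
      set s : ℤ := (p.2 : ℤ) - N with hs
      have hexp : k * p.2.choose 2 + α * p.2 + k * N * p.1 =
          (∑ i ∈ Finset.range N, (α + k * i) + k * N * N) +
              (α * tri s + β * tri (s - 1)).toNat := by
        have hnn : 0 ≤ α * tri s + β * tri (s - 1) :=
          add_nonneg (mul_nonneg (by positivity) (tri_nonneg _))
            (mul_nonneg (by positivity) (tri_nonneg _))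
        have hch : ((p.2.choose 2 : ℕ) : ℤ) = tri ((p.2 : ℤ) - 1) := by
          have h1 := two_mul_tri ((p.2 : ℤ) - 1)
          have h2 : (2 * p.2.choose 2 : ℤ) = (p.2 : ℤ) * (p.2 - 1) := by
            have h3 := Nat.choose_two_right p.2
            have h4 : 2 ∣ p.2 * (p.2 - 1) := (Nat.even_mul_pred_self p.2).two_dvd
            have h5 : 2 * p.2.choose 2 = p.2 * (p.2 - 1) := by omega
            rcases Nat.eq_zero_or_pos p.2 with h6 | h6
            · simp [h6]
            · have := congrArg (Nat.cast : ℕ → ℤ) h5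
              push_cast [Nat.cast_sub h6] at this
              exact this
          linarith
        zify
        rw [Int.toNat_of_nonneg hnn, hch]
        have hsum' := hsum
        push_cast at hsum'
        rw [hsum']
        have hk' : (k : ℤ) = α + β := by rw [← hk]; push_cast; ring
        have t1 := two_mul_tri ((p.2 : ℤ) - 1)
        have t2 := two_mul_tri ((N : ℤ) - 1)
        have t3 := two_mul_tri s
        have t4 := two_mul_tri (s - 1)
        have hp1 : (p.1 : ℤ) = N - s := by rw [hs]; linarith
        have hp2 : (p.2 : ℤ) = N + s := by rw [hs]; ring
        rw [hp2] at t1 ⊢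
        rw [hp1, hk']
        have hcancel : (2 : ℤ) ≠ 0 := two_ne_zero
        apply mul_left_cancel₀ hcancel
        linear_combination ((α : ℤ) + β) * t1 - ((α : ℤ) + β) * t2 - (α : ℤ) * t3 - (β : ℤ) * t4
      have hX := congrArg (fun m => (X : R⟦X⟧) ^ m) hexp
      simp only [pow_add, pow_mul] at hX
      rw [mul_pow, hpow, ← pow_mul X α]
      simp only [pow_mul]
      linear_combination (gaussBinom (X ^ k) p.1 p.2 * C (u : R) ^ N *
        C ((u ^ s : Rˣ) : R)) * hX

/-- **Jacobi triple product identity.** -/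
theorem jacobi_triple_product (u : Rˣ) {α β k : ℕ} (hk : α + β = k) (hk1 : 1 ≤ k) :
    progProd (u : R) α k * progProd ((u⁻¹ : Rˣ) : R) β k * progProd (-1) k k = theta u α β := by
  refine eq_of_modX fun n => ?_
  have hT : Tame fun s => α * tri s + β * tri (s - 1) := tame_theta (hk ▸ hk1)
  -- So large that the terms of degree below `n` have both Gaussian binomial indices at least `n`.
  set N : ℕ := 8 * n + 8 with hN
  have hsmall : ∀ s : ℤ, α * tri s + β * tri (s - 1) < n → -(4 * n + 4) ≤ s ∧ s ≤ 4 * n + 4 := by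
    intro s hs
    have := sq_le_theta_exponent (hk ▸ hk1) s
    constructor <;> nlinarith
  rw [map_mul, map_mul, modX_progProd _ _ hk1 (show n ≤ N by omega),
    modX_progProd _ _ hk1 (show n ≤ N by omega), ← map_mul, prod_mul_prod_eq_sum_gaussBinom u hk N,
    theta, modX_qsum hT n (Finset.Icc (-(N : ℤ)) N), ← map_mul, Finset.sum_mul, map_sum, map_sum]
  · refine Finset.sum_nbij' (fun p => (p.2 : ℤ) - N)
      (fun s => ((N - s).toNat, (N + s).toNat)) ?_ ?_ ?_ ?_ ?_
    · intro p hp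
      rw [Finset.HasAntidiagonal.mem_antidiagonal] at hp
      rw [Finset.mem_Icc]
      omega
    · intro s hs
      rw [Finset.mem_Icc] at hs
      rw [Finset.HasAntidiagonal.mem_antidiagonal]
      omega
    · rintro ⟨a, b⟩ hp
      rw [Finset.HasAntidiagonal.mem_antidiagonal] at hp
      simp only at hp
      ext <;> simp only <;> omega
    · intro s hs
      rw [Finset.mem_Icc] at hs
      simp only
      omega
    · rintro ⟨a, b⟩ hp
      rw [Finset.HasAntidiagonal.mem_antidiagonal] at hp
      simp only at hp ⊢
      by_cases hlt : α * tri ((b : ℤ) - N) + β * tri ((b : ℤ) - N - 1) < n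
      · have hb := hsmall _ hlt
        have hg := modX_progProd_mul_gaussBinom (R := R) hk1 (n := n) (a := a) (b := b)
          (by omega) (by omega)
        rw [mul_assoc, mul_comm (gaussBinom _ _ _), map_mul _ (C _ * X ^ _), hg, mul_one]
      · rw [mul_assoc, mul_right_comm, modX_eq_zero (by omega), modX_eq_zero (by omega)]
  · intro s hs
    have := hsmall s hs
    rw [Finset.mem_Icc]
    omega

end TripleProduct

/-! ### Product identities -/

section ProductIdentities

variable {R S : Type*} [CommRing R] [CommRing S]

theorem progProd_eq_mul (c : R) (r : ℕ) {k : ℕ} (hk : 1 ≤ k) :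
    progProd c r k = (1 + C c * X ^ r) * progProd c (r + k) k := by
  refine eq_of_modX fun n => ?_
  rw [map_mul, modX_progProd c r hk (Nat.le_succ n), modX_progProd c (r + k) hk le_rfl, ← map_mul,
    Finset.prod_range_succ', mul_comm (1 + C c * X ^ r)]
  congr 2
  exact Finset.prod_congr rfl fun i _ => by ring

theorem progProd_bisect (c : R) (r : ℕ) {k : ℕ} (hk : 1 ≤ k) :
    progProd c r k = progProd c r (2 * k) * progProd c (r + k) (2 * k) := by
  rw [progProd, qprod_equiv _ Equiv.natSumNatEquivNat,
    qprod_sum_type ((tame_progression r hk).comp Equiv.natSumNatEquivNat.injective)]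
  simp only [Equiv.natSumNatEquivNat_apply, Sum.elim_inl, Sum.elim_inr, progProd]
  congr 2 <;> funext i <;> ring

theorem progProd_trisect (c : R) (r : ℕ) {k : ℕ} (hk : 1 ≤ k) :
    progProd c r k = progProd c r (3 * k) *
      (progProd c (r + k) (3 * k) * progProd c (r + 2 * k) (3 * k)) := by
  have hbij := trisect_bijective (f := fun n : ℕ => 3 * n) (g := fun n => 3 * n + 1)
    (h := fun n => 3 * n + 2) (fun a b h => by simp only at h; omega)
    (fun a b h => by simp only at h; omega) (fun a b h => by simp only at h; omega)
    (fun a b => by omega) (fun a b => by omega) (fun a b => by omega) (fun i => by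
      have : i % 3 = 0 ∨ i % 3 = 1 ∨ i % 3 = 2 := by omega
      rcases this with h | h | h
      · exact Or.inl ⟨i / 3, by omega⟩
      · exact Or.inr (Or.inl ⟨i / 3, by omega⟩)
      · exact Or.inr (Or.inr ⟨i / 3, by omega⟩))
  have h1 := (tame_progression r hk).comp hbij.1
  rw [progProd, qprod_equiv _ (Equiv.ofBijective _ hbij)]
  simp only [Equiv.ofBijective_apply]
  rw [qprod_sum_type h1, qprod_sum_type (h1.comp Sum.inr_injective)]
  simp only [Sum.elim_inl, Sum.elim_inr, progProd]
  congr 2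
  · funext i; ring
  · congr 1; funext i; ring
  · congr 1; funext i; ring

theorem progProd_mul_progProd_neg (c : R) (r : ℕ) {k : ℕ} (hk : 1 ≤ k) :
    progProd c r k * progProd (-c) r k = progProd (-c ^ 2) (2 * r) (2 * k) := by
  rw [progProd, progProd, qprod_mul_qprod_neg _ (tame_progression r hk), progProd]
  congr 1
  funext i
  ring

theorem map_theta (f : R →+* S) (u : Rˣ) {α β : ℕ} (h : 1 ≤ α + β) :
    map f (theta u α β) = theta (Units.map (f : R →* S) u) α β := by
  rw [theta, map_qsum f _ (tame_theta h), theta]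
  refine qsum_congr (fun s => ?_) fun _ => rfl
  rw [← map_zpow]
  rfl

theorem tri_neg (s : ℤ) : tri (-s) = tri (s - 1) := by
  linarith [two_mul_tri (-s), two_mul_tri (s - 1)]

theorem expand_theta (m : ℕ) (hm : m ≠ 0) (u : Rˣ) (α β : ℕ) :
    expand m hm (theta u α β) = theta u (m * α) (m * β) := by
  rw [theta, expand_qsum, theta]
  refine qsum_congr (fun _ => rfl) fun s => ?_
  push_cast
  ring

/-- Euler's product `∏ (1 - X ^ (k i))`, over `i ≥ 1`. -/
noncomputable def euler (R : Type*) [CommRing R] (k : ℕ) : R⟦X⟧ := progProd (-1) k k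

theorem isUnit_euler {k : ℕ} (hk : 1 ≤ k) : IsUnit (euler R k) := isUnit_progProd _ hk hk

theorem map_euler (f : R →+* S) {k : ℕ} (hk : 1 ≤ k) : map f (euler R k) = euler S k := by
  rw [euler, map_progProd f _ _ hk, map_neg, map_one, euler]

theorem expand_euler (m : ℕ) (hm : m ≠ 0) (k : ℕ) :
    expand m hm (euler R k) = euler R (m * k) :=
  expand_progProd m hm _ k k

/-- The terms `s` and `-1 - s` cancel; on the product side there is a factor `1 - X ^ 0`. -/
theorem theta_neg_one_zero {k : ℕ} (hk : 1 ≤ k) : theta (-1 : Rˣ) k 0 = 0 := by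
  rw [← jacobi_triple_product (-1) (add_zero k) hk, progProd_eq_mul _ 0 hk]
  simp

/-- Euler's pentagonal number theorem. -/
theorem theta_neg_one_two_one : theta (-1 : Rˣ) 2 1 = euler R 1 := by
  rw [← jacobi_triple_product (-1) (show 2 + 1 = 3 from rfl) (by norm_num), euler,
    progProd_trisect _ 1 le_rfl]
  simp only [inv_neg, inv_one, Units.val_neg, Units.val_one]
  ring_nf

theorem theta_neg_one_one_two : theta (-1 : Rˣ) 1 2 = euler R 1 := by
  rw [← theta_neg_one_two_one, ← jacobi_triple_product (-1) (show 2 + 1 = 3 from rfl) (by norm_num),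
    ← jacobi_triple_product (-1) (show 1 + 2 = 3 from rfl) (by norm_num)]
  simp only [inv_neg, inv_one]
  ring

/-- The series `∑ q ^ (n ^ 2)`, known as `φ(q)`. -/
noncomputable abbrev phi (R : Type*) [CommRing R] : R⟦X⟧ := theta 1 1 1

/-- The series `∑ q ^ (3 n ^ 2 - 2 n)`, known as `Ω(q)`. -/
noncomputable abbrev omega (R : Type*) [CommRing R] : R⟦X⟧ := theta 1 1 5

/-- The series `φ(-q ^ 2)`. -/
noncomputable abbrev phi' (R : Type*) [CommRing R] : R⟦X⟧ := theta (-1) 2 2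

/-- The series `Ω(-q ^ 2)`. -/
noncomputable abbrev omega' (R : Type*) [CommRing R] : R⟦X⟧ := theta (-1) 2 10

/-- The series `ψ(-q)`, where `ψ(q) = ∑ q ^ (2 n ^ 2 - n)`. -/
noncomputable abbrev psi' (R : Type*) [CommRing R] : R⟦X⟧ := theta (-1) 1 3

theorem omega_mul_euler : omega R * euler R 1 = phi' R * theta (-1) 3 9 := by
  rw [omega, phi', ← jacobi_triple_product 1 (show 1 + 5 = 6 from rfl) (by norm_num),
    ← jacobi_triple_product (-1) (show 2 + 2 = 4 from rfl) (by norm_num),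
    ← jacobi_triple_product (-1) (show 3 + 9 = 12 from rfl) (by norm_num)]
  have h1 := progProd_bisect (-1 : R) 1 (k := 1) le_rfl
  have h2 := progProd_trisect (-1 : R) 1 (k := 2) (by norm_num)
  have h3 := progProd_bisect (-1 : R) 2 (k := 2) (by norm_num)
  have h4 := progProd_trisect (-1 : R) 2 (k := 4) (by norm_num)
  have h5 := progProd_bisect (-1 : R) 3 (k := 6) (by norm_num)
  have h6 := progProd_bisect (-1 : R) 6 (k := 6) (by norm_num)
  have h7 := progProd_mul_progProd_neg (1 : R) 1 (k := 6) (by norm_num)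
  have h8 := progProd_mul_progProd_neg (1 : R) 5 (k := 6) (by norm_num)
  norm_num at h1 h2 h3 h4 h5 h6 h7 h8
  simp only [inv_neg, inv_one, Units.val_neg, Units.val_one, euler]
  rw [h1, h2]
  rw [show progProd (1 : R) 1 6 * progProd 1 5 6 * progProd (-1) 6 6 *
      (progProd (-1) 1 6 * (progProd (-1) 3 6 * progProd (-1) 5 6) * progProd (-1) 2 2) =
        (progProd 1 1 6 * progProd (-1) 1 6) * (progProd 1 5 6 * progProd (-1) 5 6) *
        (progProd (-1) 6 6 * progProd (-1) 3 6 * progProd (-1) 2 2) by ring,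
    h7, h8, h3, h4, h5, h6]
  ring

theorem psi'_mul_omega' : ∃ F : R⟦X⟧, psi' R * omega' R = euler R 1 * expand 3 three_ne_zero F := by
  obtain ⟨G, hG⟩ := (isUnit_progProd (-1 : R) (r := 2) (k := 4) (by norm_num)
    (by norm_num)).exists_right_inv
  refine ⟨progProd (-1) 4 4 * G, ?_⟩
  have hG' := congrArg (expand 3 three_ne_zero) hG
  rw [map_mul, expand_progProd, map_one] at hG'
  rw [psi', omega', ← jacobi_triple_product (-1) (show 1 + 3 = 4 from rfl) (by norm_num),
    ← jacobi_triple_product (-1) (show 2 + 10 = 12 from rfl) (by norm_num), map_mul,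
    expand_progProd, euler]
  have h1 := progProd_bisect (-1 : R) 1 (k := 1) le_rfl
  have h2 := progProd_bisect (-1 : R) 1 (k := 2) (by norm_num)
  have h3 := progProd_bisect (-1 : R) 2 (k := 2) (by norm_num)
  have h4 := progProd_trisect (-1 : R) 2 (k := 4) (by norm_num)
  norm_num at h1 h2 h3 h4 hG'
  simp only [inv_neg, inv_one, Units.val_neg, Units.val_one]
  norm_num
  rw [h1, h2, h3, h4]
  linear_combination (-progProd (-1 : R) 1 4 * progProd (-1) 3 4 * progProd (-1) 4 4 *
    (progProd (-1) 2 12 * progProd (-1) 10 12 * progProd (-1) 12 12)) * hG'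

end ProductIdentities

/-! ### Theta series of the hexagonal lattice -/

section Hexagonal

variable {R S : Type*} [CommRing R] [CommRing S]

/-- The norm form of the hexagonal lattice. -/
def hexNorm (p : ℤ × ℤ) : ℤ := p.1 ^ 2 + p.1 * p.2 + p.2 ^ 2

/-- The norm form of the hexagonal lattice on a nontrivial coset of the lattice in its dual,
normalized to have minimum `0`. -/
def hexCosetNorm (p : ℤ × ℤ) : ℤ := p.1 ^ 2 + p.1 * p.2 + p.2 ^ 2 + p.1 + p.2

theorem tame_hexNorm : Tame hexNorm :=
  tame_of_sq_add_sq_le (fun s => by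
      simp only [hexNorm]
      nlinarith [sq_nonneg (s.1 + s.2), sq_nonneg s.1, sq_nonneg s.2])
    fun s => by simp only [hexNorm]; nlinarith [sq_nonneg (s.1 + s.2), sq_nonneg s.1, sq_nonneg s.2]

theorem tame_hexCosetNorm : Tame hexCosetNorm := by
  have h2 : ∀ s, s.1 ^ 2 + s.2 ^ 2 ≤ 4 * hexCosetNorm s + 4 := fun s => by
    simp only [hexCosetNorm]
    nlinarith [sq_nonneg (2 * (s.1 + s.2) + 2), sq_nonneg s.1, sq_nonneg s.2]
  refine tame_of_sq_add_sq_le (fun s => ?_) h2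
  have := h2 s
  by_contra hneg
  have h3 : hexCosetNorm s ≤ -1 := by omega
  have h4 : s.1 ^ 2 + s.2 ^ 2 ≤ 0 := by linarith
  have h5 : s.1 = 0 := by nlinarith [sq_nonneg s.1, sq_nonneg s.2]
  have h6 : s.2 = 0 := by nlinarith [sq_nonneg s.1, sq_nonneg s.2]
  simp [hexCosetNorm, h5, h6] at h3

/-- The theta series `a(q)` of the hexagonal lattice. -/
noncomputable def hexTheta (R : Type*) [CommRing R] : R⟦X⟧ := qsum (fun _ => 1) hexNorm

/-- The theta series of a nontrivial coset of the hexagonal lattice in its dual. -/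
noncomputable def hexCosetTheta (R : Type*) [CommRing R] : R⟦X⟧ := qsum (fun _ => 1) hexCosetNorm

theorem map_hexTheta (f : R →+* S) : map f (hexTheta R) = hexTheta S := by
  rw [hexTheta, map_qsum f _ tame_hexNorm, hexTheta]
  simp

theorem map_hexCosetTheta (f : R →+* S) : map f (hexCosetTheta R) = hexCosetTheta S := by
  rw [hexCosetTheta, map_qsum f _ tame_hexCosetNorm, hexCosetTheta]
  simp

/-- `a(q) = a(q³) + 2q κ(q³)`: the sublattice `x ≡ y mod 3` of index three is similar to the whole
lattice, and its two other cosets to the nontrivial cosets in the dual lattice. -/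
theorem hexTheta_trisect : hexTheta R = expand 3 three_ne_zero (hexTheta R) +
    2 * X * expand 3 three_ne_zero (hexCosetTheta R) := by
  have hbij := trisect_bijective (κ := ℤ × ℤ) (f := fun p => (p.1 + 2 * p.2, p.1 - p.2))
    (g := fun p => (p.1 + 2 * p.2 + 1, p.1 - p.2)) (h := fun p => (p.1 - p.2, p.1 + 2 * p.2 + 1))
    (fun a b h => by simp only [Prod.mk.injEq] at h; ext <;> omega)
    (fun a b h => by simp only [Prod.mk.injEq] at h; ext <;> omega)
    (fun a b h => by simp only [Prod.mk.injEq] at h; ext <;> omega)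
    (fun a b h => by simp only [Prod.mk.injEq] at h; omega)
    (fun a b h => by simp only [Prod.mk.injEq] at h; omega)
    (fun a b h => by simp only [Prod.mk.injEq] at h; omega)
    (fun ⟨m, n⟩ => by
      have : (m - n) % 3 = 0 ∨ (m - n) % 3 = 1 ∨ (m - n) % 3 = 2 := by omega
      rcases this with h | h | h
      · exact Or.inl ⟨(n + (m - n) / 3, (m - n) / 3), by ext <;> simp only <;> omega⟩
      · exact Or.inr (Or.inl ⟨(n + (m - n) / 3, (m - n) / 3), by ext <;> simp only <;> omega⟩)
      · exact Or.inr (Or.inr ⟨(m + (n - m) / 3, (n - m) / 3), by ext <;> simp only <;> omega⟩))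
  conv_lhs => rw [hexTheta, qsum_trisect tame_hexNorm _ _ _ hbij]
  rw [mul_assoc, two_mul, hexTheta, hexCosetTheta, expand_qsum, expand_qsum,
    X_mul_qsum _ (tame_hexCosetNorm.mul_left (by norm_num))]
  congr 1
  · exact qsum_congr (fun _ => rfl) fun p => by simp only [hexNorm]; push_cast; ring
  congr 1
  · exact qsum_congr (fun _ => rfl) fun p => by simp only [hexNorm, hexCosetNorm]; push_cast; ring
  · exact qsum_congr (fun _ => rfl) fun p => by simp only [hexNorm, hexCosetNorm]; push_cast; ring

/-- The cube of `Θ(u) = ∑ uˢ q^(s(s+1)/2)`: the triples of integers with sum `s` form a copy of the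
hexagonal lattice if `3 ∣ s`, and of a nontrivial coset of it otherwise. -/
theorem theta_cube (u : Rˣ) : theta u 1 0 ^ 3 =
    qsum (fun t : ℤ => ((u ^ (3 * t) : Rˣ) : R)) (fun t => 3 * tri t) * hexTheta R +
    (qsum (fun t : ℤ => ((u ^ (3 * t - 1) : Rˣ) : R)) (fun t => 2 * tri t + tri (t - 1)) +
      qsum (fun t : ℤ => ((u ^ (3 * t - 2) : Rˣ) : R)) (fun t => tri t + 2 * tri (t - 1))) *
      hexCosetTheta R := by
  have hT : Tame fun s => ((1 : ℕ) : ℤ) * tri s + (0 : ℕ) * tri (s - 1) := tame_theta (by norm_num)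
  have hT1 : Tame fun s => 2 * tri s + tri (s - 1) := by
    simpa using tame_theta (α := 2) (β := 1) (by norm_num)
  have hT2 : Tame fun s => tri s + 2 * tri (s - 1) := by
    simpa using tame_theta (α := 1) (β := 2) (by norm_num)
  have hbij := trisect_bijective (ι := (ℤ × ℤ) × ℤ) (κ := ℤ × (ℤ × ℤ))
    (f := fun p => ((p.1 + p.2.1, p.1 + p.2.2), p.1 - p.2.1 - p.2.2))
    (g := fun p => ((p.1 + p.2.1, p.1 + p.2.2), p.1 - 1 - p.2.1 - p.2.2))
    (h := fun p => ((p.1 - 1 - p.2.1, p.1 - 1 - p.2.2), p.1 + p.2.1 + p.2.2))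
    (fun a b h => by simp only [Prod.mk.injEq] at h; ext <;> omega)
    (fun a b h => by simp only [Prod.mk.injEq] at h; ext <;> omega)
    (fun a b h => by simp only [Prod.mk.injEq] at h; ext <;> omega)
    (fun a b h => by simp only [Prod.mk.injEq] at h; omega)
    (fun a b h => by simp only [Prod.mk.injEq] at h; omega)
    (fun a b h => by simp only [Prod.mk.injEq] at h; omega)
    (fun ⟨⟨i, j⟩, k⟩ => by
      obtain ⟨t, ht⟩ : ∃ t, t = (i + j + k + 2) / 3 := ⟨_, rfl⟩
      have : i + j + k = 3 * t ∨ i + j + k = 3 * t - 1 ∨ i + j + k = 3 * t - 2 := by omega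
      rcases this with h | h | h
      · exact Or.inl ⟨(t, i - t, j - t), by ext <;> simp only <;> omega⟩
      · exact Or.inr (Or.inl ⟨(t, i - t, j - t), by ext <;> simp only <;> omega⟩)
      · exact Or.inr (Or.inr ⟨(t, t - 1 - i, t - 1 - j), by ext <;> simp only <;> omega⟩))
  rw [pow_succ, sq, theta, qsum_mul hT hT, qsum_mul (hT.prod hT) hT,
    qsum_trisect ((hT.prod hT).prod hT) _ _ _ hbij, hexTheta, hexCosetTheta, add_mul,
    qsum_mul (tame_tri.mul_left (by norm_num)) tame_hexNorm, qsum_mul hT1 tame_hexCosetNorm,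
    qsum_mul hT2 tame_hexCosetNorm]
  simp only [← Units.val_mul, ← zpow_add, mul_one, Nat.cast_one, Nat.cast_zero, one_mul, zero_mul,
    add_zero]
  congr 1
  · refine qsum_congr (fun p => ?_) fun p => ?_
    · congr 2; ring
    · apply mul_left_cancel₀ (two_ne_zero (α := ℤ))
      simp only [mul_add, two_mul_tri, hexNorm]
      linear_combination (-3) * two_mul_tri p.1
  congr 1
  · refine qsum_congr (fun p => ?_) fun p => ?_
    · congr 2; ring
    · apply mul_left_cancel₀ (two_ne_zero (α := ℤ))
      simp only [mul_add, two_mul_tri, hexCosetNorm]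
      ring
  · refine qsum_congr (fun p => ?_) fun p => ?_
    · congr 2; ring
    · apply mul_left_cancel₀ (two_ne_zero (α := ℤ))
      simp only [mul_add, two_mul_tri, hexCosetNorm]
      ring

end Hexagonal

/-! ### Specializations of the triple product -/

section CoeffMap

variable {R S ι : Type*} [CommRing R] [CommRing S]

/-- Application of an additive map to all coefficients of a power series. -/
noncomputable def coeffMap (f : R →+ S) : R⟦X⟧ →+ S⟦X⟧ where
  toFun F := mk fun n => f (coeff n F)
  map_zero' := by ext n; simp
  map_add' F G := by ext n; simp

@[simp]
theorem coeff_coeffMap (f : R →+ S) (F : R⟦X⟧) (n : ℕ) :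
    coeff n (coeffMap f F) = f (coeff n F) := by
  simp [coeffMap]

theorem coeffMap_qsum (f : R →+ S) (w : ι → R) {e : ι → ℤ} (he : Tame e) :
    coeffMap f (qsum w e) = qsum (fun i => f (w i)) e := by
  ext n
  rw [coeff_coeffMap, coeff_qsum_map f w he]

theorem coeffMap_mul_map (f : R →+ S) (i : S →+* R) (h : ∀ x s, f (x * i s) = f x * s) (F : R⟦X⟧)
    (G : S⟦X⟧) : coeffMap f (F * map i G) = coeffMap f F * G := by
  ext n
  simp only [coeff_coeffMap, coeff_mul, map_sum, coeff_map, h]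

end CoeffMap

/-- The unit `-(1 + ε)` of the dual numbers. The triple product and its consequences at this point
express their values and first derivatives at `-1`. -/
def dualUnit : (DualNumber ℤ)ˣ where
  val := -(1 + DualNumber.eps)
  inv := -(1 - DualNumber.eps)
  val_inv := by
    have := DualNumber.eps_mul_eps (R := ℤ)
    linear_combination -this
  inv_val := by
    have := DualNumber.eps_mul_eps (R := ℤ)
    linear_combination -this

theorem val_dualUnit : (dualUnit : DualNumber ℤ) = -(1 + DualNumber.eps) := rfl

theorem val_inv_dualUnit :
    ((dualUnit⁻¹ : (DualNumber ℤ)ˣ) : DualNumber ℤ) = -(1 - DualNumber.eps) :=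
  rfl

/-- Signs `(-1) ^ s` with integer exponents. -/
abbrev sgn (s : ℤ) : ℤ := (((-1 : ℤˣ) ^ s : ℤˣ) : ℤ)

theorem sgn_add (s t : ℤ) : sgn (s + t) = sgn s * sgn t := by
  simp only [sgn, zpow_add, Units.val_mul]

theorem sgn_neg (s : ℤ) : sgn (-s) = sgn s := by
  simp only [sgn, zpow_neg, ← inv_zpow, inv_neg, inv_one]

theorem sgn_one : sgn 1 = -1 := by simp [sgn]

theorem sgn_sub (s t : ℤ) : sgn (s - t) = sgn s * sgn t := by
  rw [sub_eq_add_neg, sgn_add, sgn_neg]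

theorem sgn_mul_self (s : ℤ) : sgn s * sgn s = 1 := by
  simp only [sgn, ← Units.val_mul, Int.units_mul_self, Units.val_one]

theorem sgn_three_mul (s : ℤ) : sgn (3 * s) = sgn s := by
  rw [show 3 * s = s + s + s by ring, sgn_add, sgn_add, sgn_mul_self, one_mul]

theorem sgn_two : sgn 2 = 1 := by simp [sgn]

theorem dualUnit_zpow (s : ℤ) :
    ((dualUnit ^ s : (DualNumber ℤ)ˣ) : DualNumber ℤ) =
      TrivSqZeroExt.inl (sgn s) + TrivSqZeroExt.inr (sgn s * s) := by
  have h1 : (dualUnit : DualNumber ℤ) = TrivSqZeroExt.inl (-1) + TrivSqZeroExt.inr (-1) := by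
    rw [val_dualUnit]
    ext <;> simp
  have h2 : ((dualUnit⁻¹ : (DualNumber ℤ)ˣ) : DualNumber ℤ) =
      TrivSqZeroExt.inl (-1) + TrivSqZeroExt.inr 1 := by
    rw [val_inv_dualUnit]
    ext <;> simp
  induction s using Int.induction_on with
  | zero => ext <;> simp [sgn]
  | succ n ih =>
    rw [zpow_add_one, Units.val_mul, ih, h1, sgn_add, sgn_one]
    ext
    · simp
    · simp; ring
  | pred n ih =>
    rw [zpow_sub_one, Units.val_mul, ih, h2, sgn_sub, sgn_one]
    ext
    · simp
    · simp; ring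

/-- The derivative part of a power series over the dual numbers. -/
noncomputable def epsPart : (DualNumber ℤ)⟦X⟧ →+ ℤ⟦X⟧ :=
  coeffMap (TrivSqZeroExt.sndHom ℤ ℤ).toAddMonoidHom

theorem epsPart_qsum (m : ℤ → ℤ) {e : ℤ → ℤ} (he : Tame e) :
    epsPart (qsum (fun s => ((dualUnit ^ (m s) : (DualNumber ℤ)ˣ) : DualNumber ℤ)) e) =
      qsum (fun s => sgn (m s) * m s) e := by
  rw [epsPart, coeffMap_qsum _ _ he]
  refine qsum_congr (fun s => ?_) fun _ => rfl
  rw [dualUnit_zpow]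
  simp

theorem epsPart_mul_map (F : (DualNumber ℤ)⟦X⟧) (G : ℤ⟦X⟧) :
    epsPart (F * map (TrivSqZeroExt.inlHom ℤ ℤ) G) = epsPart F * G :=
  coeffMap_mul_map _ _ (fun x s => by simp [mul_comm]) F G

theorem epsPart_eps_mul (F : (DualNumber ℤ)⟦X⟧) :
    epsPart (C DualNumber.eps * F) = map (TrivSqZeroExt.fstHom ℤ ℤ ℤ).toRingHom F := by
  ext n
  simp [epsPart, coeff_C_mul]

theorem theta_dualUnit : theta dualUnit 1 0 = C DualNumber.eps *
    (progProd (dualUnit : DualNumber ℤ) 1 1 *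
      progProd ((dualUnit⁻¹ : (DualNumber ℤ)ˣ) : DualNumber ℤ) 1 1 * progProd (-1) 1 1) := by
  rw [← jacobi_triple_product _ (add_zero 1) le_rfl, progProd_eq_mul _ 0 le_rfl]
  have : (1 : (DualNumber ℤ)⟦X⟧) + C ((dualUnit⁻¹ : (DualNumber ℤ)ˣ) : DualNumber ℤ) =
      C DualNumber.eps := by
    rw [← map_one (C : DualNumber ℤ →+* _), ← map_add]
    exact congrArg C (by rw [val_inv_dualUnit]; ring)
  rw [pow_zero, mul_one, this]
  ring

theorem tame_tri_two_one : Tame fun s => 2 * tri s + tri (s - 1) := by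
  simpa using tame_theta (α := 2) (β := 1) (by norm_num)

theorem tame_tri_one_two : Tame fun s => tri s + 2 * tri (s - 1) := by
  simpa using tame_theta (α := 1) (β := 2) (by norm_num)

/-- Jacobi's identity `∏ (1 - qⁿ)³ = ∑ (-1)ˢ s q^(s(s+1)/2)`, over all integers `s`. -/
theorem euler_cube : euler ℤ 1 ^ 3 = qsum (fun s => sgn s * s) tri := by
  have h := congrArg epsPart theta_dualUnit
  rw [epsPart_eps_mul, map_mul, map_mul, map_progProd _ _ _ le_rfl, map_progProd _ _ _ le_rfl,
    map_progProd _ _ _ le_rfl] at h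
  have h2 : theta dualUnit 1 0 =
      qsum (fun s => ((dualUnit ^ s : (DualNumber ℤ)ˣ) : DualNumber ℤ)) tri := by
    rw [theta]
    exact qsum_congr (fun _ => rfl) fun s => by push_cast; ring
  rw [h2, epsPart_qsum (fun s => s) tame_tri] at h
  rw [h, pow_succ, sq, euler]
  congr 2

/-- The degree `0` part of the trisection of `∏ (1 - qⁿ)³`, with `q³` replaced by `q`. -/
noncomputable def eulerCubePart : ℤ⟦X⟧ :=
  qsum (fun s => sgn s * (6 * s + 1)) (fun s => 2 * tri s + tri (s - 1))

theorem expand_tri_qsum :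
    qsum (fun t : ℤ => sgn t * t) (fun t => 3 * tri t) = euler ℤ 3 ^ 3 := by
  rw [show euler ℤ 3 = expand 3 three_ne_zero (euler ℤ 1) from (expand_euler 3 _ 1).symm, ← map_pow,
    euler_cube, expand_qsum]
  rfl

/-- The derivative at `u = -1` of the formula for the cube of `Θ(u)`, which vanishes there to third
order. -/
theorem three_mul_euler_cube_mul_hexTheta :
    3 * euler ℤ 3 ^ 3 * hexTheta ℤ = eulerCubePart * hexCosetTheta ℤ := by
  have h := congrArg epsPart (theta_cube dualUnit)
  have h0 : theta dualUnit 1 0 ^ 3 = 0 := by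
    have := congrArg (C : DualNumber ℤ →+* (DualNumber ℤ)⟦X⟧) (DualNumber.eps_mul_eps (R := ℤ))
    rw [map_mul, map_zero] at this
    rw [theta_dualUnit, mul_pow, pow_succ, sq, this, zero_mul, zero_mul]
  rw [h0, map_zero, ← map_hexTheta (TrivSqZeroExt.inlHom ℤ ℤ),
    ← map_hexCosetTheta (TrivSqZeroExt.inlHom ℤ ℤ), map_add, epsPart_mul_map, epsPart_mul_map,
    map_add, epsPart_qsum _ (tame_tri.mul_left (by norm_num)), epsPart_qsum _ tame_tri_two_one,
    epsPart_qsum _ tame_tri_one_two] at h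
  have h1 : qsum (fun t : ℤ => sgn (3 * t) * (3 * t)) (fun t => 3 * tri t) = 3 * euler ℤ 3 ^ 3 := by
    rw [← expand_tri_qsum, show (3 : ℤ⟦X⟧) = C 3 from (map_ofNat C 3).symm,
      C_mul_qsum _ _ (tame_tri.mul_left (by norm_num))]
    exact qsum_congr (fun t => by rw [sgn_three_mul]; ring) fun _ => rfl
  have h2 : qsum (fun t : ℤ => sgn (3 * t - 2) * (3 * t - 2)) (fun t => tri t + 2 * tri (t - 1)) =
      qsum (fun t : ℤ => sgn t * (-3 * t - 2)) (fun t => 2 * tri t + tri (t - 1)) := by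
    rw [qsum_equiv _ _ (Equiv.neg ℤ)]
    refine qsum_congr (fun t => ?_) fun t => ?_
    · simp only [Equiv.neg_apply]
      rw [sgn_sub, sgn_three_mul, sgn_neg, sgn_two]
      ring
    · simp only [Equiv.neg_apply]
      rw [tri_neg, show -t - 1 = -(t + 1) by ring, tri_neg, add_sub_cancel_right]
      ring
  have h3 : qsum (fun t : ℤ => sgn (3 * t - 1) * (3 * t - 1)) (fun t => 2 * tri t + tri (t - 1)) +
      qsum (fun t : ℤ => sgn t * (-3 * t - 2)) (fun t => 2 * tri t + tri (t - 1)) =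
      -eulerCubePart := by
    rw [eulerCubePart, neg_qsum _ tame_tri_two_one, qsum_add _ _ tame_tri_two_one]
    exact qsum_congr (fun t => by rw [sgn_sub, sgn_three_mul, sgn_one]; ring) fun _ => rfl
  rw [h1, h2, h3] at h
  linear_combination -h

/-- `E(q)³ = P(q³) - 3q E(q⁹)³`. -/
theorem euler_cube_trisect :
    euler ℤ 1 ^ 3 = expand 3 three_ne_zero eulerCubePart - 3 * X * euler ℤ 9 ^ 3 := by
  have hbij := trisect_bijective (κ := ℤ) (f := fun t : ℤ => 3 * t)
    (g := fun t => -3 * t - 1) (h := fun t => 3 * t + 1)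
    (fun a b h => by simp only at h; omega) (fun a b h => by simp only at h; omega)
    (fun a b h => by simp only at h; omega)
    (fun a b => by omega) (fun a b => by omega) (fun a b => by omega) (fun i => by
      have : i % 3 = 0 ∨ i % 3 = 1 ∨ i % 3 = 2 := by omega
      rcases this with h | h | h
      · exact Or.inl ⟨i / 3, by omega⟩
      · exact Or.inr (Or.inr ⟨i / 3, by omega⟩)
      · exact Or.inr (Or.inl ⟨-i / 3, by omega⟩))
  have ht9 : Tame fun t => 9 * tri t := tame_tri.mul_left (by norm_num)
  have ht : Tame fun t => 3 * (2 * tri t + tri (t - 1)) := tame_tri_two_one.mul_left (by norm_num)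
  have h9 : euler ℤ 9 ^ 3 = qsum (fun t => sgn t * t) (fun t => 9 * tri t) := by
    rw [show euler ℤ 9 = expand 9 (by norm_num) (euler ℤ 1) from (expand_euler 9 _ 1).symm,
      ← map_pow, euler_cube, expand_qsum]
    rfl
  have h0 : qsum (fun t => sgn t) (fun t => 9 * tri t) = 0 := by
    rw [← theta_neg_one_zero (R := ℤ) (k := 9) (by norm_num), theta]
    refine qsum_congr (fun t => rfl) fun t => ?_
    push_cast
    ring
  rw [euler_cube, qsum_trisect tame_tri _ _ _ hbij, ← add_assoc]
  have e1 : qsum (fun t : ℤ => sgn (3 * t) * (3 * t)) (fun t => tri (3 * t)) +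
      qsum (fun t : ℤ => sgn (-3 * t - 1) * (-3 * t - 1)) (fun t => tri (-3 * t - 1)) =
      expand 3 three_ne_zero eulerCubePart := by
    have h1 : ∀ t, tri (3 * t) = 3 * (2 * tri t + tri (t - 1)) := fun t => by
      linarith [two_mul_tri (3 * t), two_mul_tri t, two_mul_tri (t - 1)]
    have h2 : ∀ t, tri (-3 * t - 1) = 3 * (2 * tri t + tri (t - 1)) := fun t => by
      linarith [two_mul_tri (-3 * t - 1), two_mul_tri t, two_mul_tri (t - 1)]
    rw [eulerCubePart, expand_qsum]
    simp only [h1, h2]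
    rw [qsum_add _ _ ht]
    refine qsum_congr (fun t => ?_) fun t => by push_cast; ring
    rw [sgn_sub, show -3 * t = -(3 * t) by ring, sgn_neg, sgn_three_mul, sgn_one]
    ring
  have e2 : qsum (fun t : ℤ => sgn (3 * t + 1) * (3 * t + 1)) (fun t => tri (3 * t + 1)) =
      -(3 * X * euler ℤ 9 ^ 3) := by
    have h1 : ∀ t, tri (3 * t + 1) = 9 * tri t + 1 := fun t => by
      linarith [two_mul_tri (3 * t + 1), two_mul_tri t]
    simp only [h1]
    rw [← X_mul_qsum _ ht9, h9]
    have e3 : qsum (fun t : ℤ => sgn (3 * t + 1) * (3 * t + 1)) (fun t => 9 * tri t) =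
        C (-3) * qsum (fun t => sgn t * t) (fun t => 9 * tri t) +
          -qsum (fun t => sgn t) (fun t => 9 * tri t) := by
      rw [C_mul_qsum _ _ ht9, neg_qsum _ ht9, qsum_add _ _ ht9]
      exact qsum_congr (fun t => by rw [sgn_add, sgn_three_mul, sgn_one]; ring) fun _ => rfl
    rw [e3, h0, map_neg, map_ofNat]
    ring
  rw [e1, e2]
  ring

/-- The formula for the cube of `Θ(u)` at `u = -ω`, with `ω` a primitive third root of unity. -/
theorem hexCosetTheta_mul_euler : hexCosetTheta ℤ * euler ℤ 1 = 3 * euler ℤ 3 ^ 3 := by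
  obtain ⟨w, hw⟩ : ∃ w : ℂ, w ^ 2 + w + 1 = 0 := by
    obtain ⟨w, hw⟩ := IsAlgClosed.exists_root (Polynomial.X ^ 2 + Polynomial.X + 1 : Polynomial ℂ)
      (by
        have : (Polynomial.X ^ 2 + Polynomial.X + 1 : Polynomial ℂ).degree = 2 := by compute_degree!
        rw [this]; norm_num)
    exact ⟨w, by simpa [Polynomial.IsRoot] using hw⟩
  have hw3 : w ^ 3 = 1 := by linear_combination (w - 1) * hw
  have hne : w - w ^ 2 ≠ 0 := by
    intro h0
    have h1 : w = 1 / 2 * (w ^ 2 + w + 1) + 1 / 2 * (w - w ^ 2) - 1 / 2 := by ring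
    rw [hw, h0] at h1
    rw [h1] at hw
    norm_num at hw
  let u : ℂˣ := ⟨-w, -w ^ 2, by linear_combination hw3, by linear_combination hw3⟩
  have hu : (u : ℂ) = -w := rfl
  have hui : ((u⁻¹ : ℂˣ) : ℂ) = -w ^ 2 := rfl
  have hu3 : u ^ 3 = -1 := by
    ext
    rw [Units.val_pow_eq_pow_val, hu, Units.val_neg, Units.val_one]
    linear_combination -hw3
  have hl : theta u 1 0 = C (1 - w ^ 2) * euler ℂ 3 := by
    have h3 := qprod_mul_qprod_mul_qprod hw (tame_progression 1 le_rfl)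
    rw [← jacobi_triple_product u (add_zero 1) le_rfl, progProd_eq_mul _ 0 le_rfl, hu, hui]
    have h4 : euler ℂ 3 = qprod (fun _ => (-1 : ℂ)) (fun i => 3 * (1 + 1 * i)) := by
      rw [euler, progProd]
      congr 1
      funext i
      ring
    rw [h4, ← h3, map_sub, map_one, map_neg]
    simp only [progProd, zero_add, pow_zero]
    ring
  have hz : ∀ t : ℤ, u ^ (3 * t) = (-1) ^ t := fun t => by
    rw [zpow_mul, ← hu3]
    norm_cast
  have hc := theta_cube u
  have h1 : qsum (fun t : ℤ => ((u ^ (3 * t) : ℂˣ) : ℂ)) (fun t => 3 * tri t) = 0 := by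
    rw [← theta_neg_one_zero (R := ℂ) (k := 3) (by norm_num), theta]
    exact qsum_congr (fun t => by rw [hz]) fun t => by push_cast; ring
  have h2 : qsum (fun t : ℤ => ((u ^ (3 * t - 1) : ℂˣ) : ℂ)) (fun t => 2 * tri t + tri (t - 1)) =
      C (-w ^ 2) * euler ℂ 1 := by
    rw [← theta_neg_one_two_one, theta, C_mul_qsum _ _ (tame_theta (by norm_num))]
    refine qsum_congr (fun t => ?_) fun t => by push_cast; ring
    rw [zpow_sub_one, Units.val_mul, hz, hui, mul_comm]
  have h3 : qsum (fun t : ℤ => ((u ^ (3 * t - 2) : ℂˣ) : ℂ)) (fun t => tri t + 2 * tri (t - 1)) =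
      C w * euler ℂ 1 := by
    rw [← theta_neg_one_one_two, theta, C_mul_qsum _ _ (tame_theta (by norm_num))]
    refine qsum_congr (fun t => ?_) fun t => by push_cast; ring
    rw [show 3 * t - 2 = 3 * t - 1 - 1 by ring, zpow_sub_one, zpow_sub_one, Units.val_mul,
      Units.val_mul, hz, hui]
    linear_combination (((-1 : ℂˣ) ^ t : ℂˣ) : ℂ) * w * hw3
  rw [hl, h1, h2, h3, mul_pow, ← map_pow, zero_mul, zero_add, ← add_mul, ← map_add,
    show (1 - w ^ 2) ^ 3 = (w - w ^ 2) * 3 by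
      linear_combination (3 * w - w ^ 3 - 1) * hw3,
    show -w ^ 2 + w = w - w ^ 2 by ring, map_mul, map_ofNat, mul_assoc, mul_assoc] at hc
  have hC : (C (w - w ^ 2) : ℂ⟦X⟧) ≠ 0 := fun h0 => hne (C_injective (by rw [h0, map_zero]))
  have hc' := mul_left_cancel₀ hC hc
  apply map_injective (Int.castRingHom ℂ) Int.cast_injective
  rw [map_mul, map_mul, map_pow, map_hexCosetTheta, map_euler _ le_rfl, map_euler _ (by norm_num),
    map_ofNat, hc', mul_comm]

theorem hexTheta_mul_euler : hexTheta ℤ * euler ℤ 1 = eulerCubePart := by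
  have h1 := three_mul_euler_cube_mul_hexTheta
  have h2 := hexCosetTheta_mul_euler
  have h3 : euler ℤ 3 ≠ 0 := (isUnit_euler (by norm_num)).ne_zero
  have h4 : (3 : ℤ⟦X⟧) * euler ℤ 3 ^ 3 ≠ 0 :=
    mul_ne_zero (fun h => by
      have := congrArg constantCoeff h
      rw [map_ofNat, map_zero] at this
      norm_num at this) (pow_ne_zero _ h3)
  apply mul_left_cancel₀ h4
  linear_combination euler ℤ 1 * h1 + eulerCubePart * h2

theorem euler_cube_eq : euler ℤ 1 ^ 3 =
    euler ℤ 3 * expand 3 three_ne_zero (hexTheta ℤ) - 3 * X * euler ℤ 9 ^ 3 := by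
  rw [euler_cube_trisect, ← hexTheta_mul_euler, map_mul, expand_euler, mul_comm]

/-! ### The generating function -/

section ConstantTerm

open scoped LaurentPolynomial

/-- The constant term of a Laurent polynomial. -/
noncomputable def constTerm : ℤ[T;T⁻¹] →+ ℤ where
  toFun x := x.coeff 0
  map_zero' := by simp
  map_add' x y := by simp

theorem constTerm_T (n : ℤ) : constTerm (LaurentPolynomial.T n) = if n = 0 then 1 else 0 :=
  LaurentPolynomial.T_apply 0 n

theorem constTerm_mul_C (x : ℤ[T;T⁻¹]) (r : ℤ) :
    constTerm (x * LaurentPolynomial.C r) = constTerm x * r := by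
  rw [LaurentPolynomial.C_eq_algebraMap, mul_comm, ← Algebra.smul_def, map_zsmul,
    smul_eq_mul, mul_comm]

/-- The variable of the Laurent polynomials, as a unit. -/
noncomputable def unitT : (ℤ[T;T⁻¹])ˣ where
  val := LaurentPolynomial.T 1
  inv := LaurentPolynomial.T (-1)
  val_inv := by rw [← LaurentPolynomial.T_add]; simp
  inv_val := by rw [← LaurentPolynomial.T_add]; simp

theorem val_unitT : (unitT : ℤ[T;T⁻¹]) = LaurentPolynomial.T 1 := rfl

theorem val_inv_unitT : ((unitT⁻¹ : (ℤ[T;T⁻¹])ˣ) : ℤ[T;T⁻¹]) = LaurentPolynomial.T (-1) := rfl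

theorem unitT_zpow (s : ℤ) : ((unitT ^ s : (ℤ[T;T⁻¹])ˣ) : ℤ[T;T⁻¹]) = LaurentPolynomial.T s := by
  induction s using Int.induction_on with
  | zero => simp
  | succ n ih => rw [zpow_add_one, Units.val_mul, ih, val_unitT, LaurentPolynomial.T_add]
  | pred n ih => rw [zpow_sub_one, Units.val_mul, ih, val_inv_unitT, ← LaurentPolynomial.T_add,
      sub_eq_add_neg]

/-- The constant term, coefficient by coefficient, of a power series over the Laurent
polynomials. -/
noncomputable def constPart : (ℤ[T;T⁻¹])⟦X⟧ →+ ℤ⟦X⟧ := coeffMap constTerm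

theorem constPart_mul_map (F : (ℤ[T;T⁻¹])⟦X⟧) (G : ℤ⟦X⟧) :
    constPart (F * map LaurentPolynomial.C G) = constPart F * G :=
  coeffMap_mul_map _ _ constTerm_mul_C F G

theorem constPart_qsum_mul_qsum {ι κ : Type*} (m : ι → ℤ) (m' : κ → ℤ) {e : ι → ℤ} {e' : κ → ℤ}
    (he : Tame e) (he' : Tame e') :
    constPart (qsum (fun s => ((unitT ^ m s : (ℤ[T;T⁻¹])ˣ) : ℤ[T;T⁻¹])) e *
        qsum (fun s => ((unitT ^ m' s : (ℤ[T;T⁻¹])ˣ) : ℤ[T;T⁻¹])) e') =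
      qsum (fun p : ι × κ => if m p.1 + m' p.2 = 0 then 1 else 0) (fun p => e p.1 + e' p.2) := by
  rw [qsum_mul he he', constPart, coeffMap_qsum _ _ (he.prod he')]
  refine qsum_congr (fun p => ?_) fun _ => rfl
  rw [unitT_zpow, unitT_zpow, ← LaurentPolynomial.T_add, constTerm_T]

theorem qsum_zero {ι : Type*} {w : ι → ℤ} (hw : ∀ i, w i = 0) (e : ι → ℤ) : qsum w e = 0 := by
  ext n
  simp [qsum, hw]

theorem constPart_theta_pow_six : constPart (theta unitT 1 0 ^ 6) =
    expand 3 three_ne_zero (phi ℤ) * hexTheta ℤ ^ 2 + 2 * X * omega ℤ * hexCosetTheta ℤ ^ 2 := by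
  have ht0 : Tame fun t => 3 * tri t := tame_tri.mul_left (by norm_num)
  rw [show 6 = 3 * 2 by norm_num, pow_mul, theta_cube, ← map_hexTheta LaurentPolynomial.C,
    ← map_hexCosetTheta LaurentPolynomial.C]
  set A := qsum (fun t : ℤ => ((unitT ^ (3 * t) : (ℤ[T;T⁻¹])ˣ) : ℤ[T;T⁻¹])) (fun t => 3 * tri t)
    with hA
  set B := qsum (fun t : ℤ => ((unitT ^ (3 * t - 1) : (ℤ[T;T⁻¹])ˣ) : ℤ[T;T⁻¹]))
    (fun t => 2 * tri t + tri (t - 1)) with hB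
  set D := qsum (fun t : ℤ => ((unitT ^ (3 * t - 2) : (ℤ[T;T⁻¹])ˣ) : ℤ[T;T⁻¹]))
    (fun t => tri t + 2 * tri (t - 1)) with hD
  have hAA : constPart (A * A) = expand 3 three_ne_zero (phi ℤ) := by
    rw [hA, constPart_qsum_mul_qsum _ _ ht0 ht0, phi, expand_theta, theta,
      qsum_comp_injective (f := fun t : ℤ => (t, -t)) (fun a b h => by simpa using h)]
    · refine qsum_congr (fun t => ?_) fun t => ?_
      · rw [if_pos (by ring)]; simp
      · simp only [tri_neg]; push_cast; ring
    · rintro ⟨a, b⟩ h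
      rw [if_neg]
      intro h'
      exact h ⟨a, by ext <;> simp only at h' ⊢; omega⟩
  have hAB : constPart (A * B) = 0 := by
    rw [hA, hB, constPart_qsum_mul_qsum _ _ ht0 tame_tri_two_one]
    exact qsum_zero (fun p => by rw [if_neg]; omega) _
  have hAD : constPart (A * D) = 0 := by
    rw [hA, hD, constPart_qsum_mul_qsum _ _ ht0 tame_tri_one_two]
    exact qsum_zero (fun p => by rw [if_neg]; omega) _
  have hBB : constPart (B * B) = 0 := by
    rw [hB, constPart_qsum_mul_qsum _ _ tame_tri_two_one tame_tri_two_one]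
    exact qsum_zero (fun p => by rw [if_neg]; omega) _
  have hDD : constPart (D * D) = 0 := by
    rw [hD, constPart_qsum_mul_qsum _ _ tame_tri_one_two tame_tri_one_two]
    exact qsum_zero (fun p => by rw [if_neg]; omega) _
  have hBD : constPart (B * D) = X * omega ℤ := by
    rw [hB, hD, constPart_qsum_mul_qsum _ _ tame_tri_two_one tame_tri_one_two, omega, theta,
      X_mul_qsum _ (tame_theta (by norm_num)),
      qsum_comp_injective (f := fun t : ℤ => (t, 1 - t)) (fun a b h => by simpa using h)]
    · refine qsum_congr (fun t => ?_) fun t => ?_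
      · rw [if_pos (by ring)]; simp
      · push_cast
        linarith [two_mul_tri t, two_mul_tri (t - 1), two_mul_tri (1 - t), two_mul_tri (1 - t - 1)]
    · rintro ⟨a, b⟩ h
      rw [if_neg]
      intro h'
      exact h ⟨a, by ext <;> simp only at h' ⊢; omega⟩
  rw [show (A * map LaurentPolynomial.C (hexTheta ℤ) +
      (B + D) * map LaurentPolynomial.C (hexCosetTheta ℤ)) ^ 2 =
      A * A * map LaurentPolynomial.C (hexTheta ℤ ^ 2) +
      (A * B + A * D) * map LaurentPolynomial.C (2 * hexTheta ℤ * hexCosetTheta ℤ) +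
      (B * B + D * D + (B * D + B * D)) * map LaurentPolynomial.C (hexCosetTheta ℤ ^ 2) by
    simp only [map_mul, map_pow, map_ofNat]; ring]
  simp only [map_add, constPart_mul_map, hAA, hAB, hAD, hBB, hDD, hBD]
  ring

/-- The generating function of the numbers `cφ₆(n)`. -/
noncomputable def cphiSeries : ℤ⟦X⟧ := mk fun n => (cphi 6 n : ℤ)

/-- The two rows of a partition enter through `∏ (1 + z qⁿ⁺¹)⁶` and `∏ (1 + z⁻¹ qⁿ)⁶`, and they have
equal length when the power of `z` is zero. -/
theorem cphiSeries_eq_constPart : cphiSeries = constPart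
    ((progProd (unitT : ℤ[T;T⁻¹]) 1 1 *
      progProd ((unitT⁻¹ : (ℤ[T;T⁻¹])ˣ) : ℤ[T;T⁻¹]) 0 1) ^ 6) := by
  have h1 := tame_progression 1 (k := 1) le_rfl
  have h0 := tame_progression 0 (k := 1) le_rfl
  have key : ∀ r : ℕ, Tame (fun p : ℕ × Fin 6 => ((r + 1 * p.1 : ℕ) : ℤ)) := fun r =>
    ⟨fun p => by positivity, fun n => (((tame_progression r (k := 1) le_rfl).finite n).prod
      Set.finite_univ).subset fun p hp => ⟨hp, Set.mem_univ _⟩⟩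
  rw [mul_pow, progProd, progProd, ← qprod_prod_fin 6 _ h1, ← qprod_prod_fin 6 _ h0, qprod, qprod]
  have hw : ∀ A : Finset (ℕ × Fin 6), ∏ _i ∈ A, (unitT : ℤ[T;T⁻¹]) =
      ((unitT ^ (A.card : ℤ) : (ℤ[T;T⁻¹])ˣ) : ℤ[T;T⁻¹]) := fun A => by
    rw [Finset.prod_const, zpow_natCast, Units.val_pow_eq_pow_val]
  have hw' : ∀ A : Finset (ℕ × Fin 6), ∏ _i ∈ A, ((unitT⁻¹ : (ℤ[T;T⁻¹])ˣ) : ℤ[T;T⁻¹]) =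
      ((unitT ^ (-(A.card : ℤ)) : (ℤ[T;T⁻¹])ˣ) : ℤ[T;T⁻¹]) := fun A => by
    rw [Finset.prod_const, zpow_neg, ← inv_zpow, zpow_natCast, Units.val_pow_eq_pow_val]
  simp only [hw, hw']
  rw [constPart_qsum_mul_qsum _ _ (key 1).finset (key 0).finset]
  ext n
  obtain ⟨s, hs⟩ := ((key 1).finset.prod (key 0).finset).exists_finset n
  rw [coeff_qsum _ _ n s fun i hi => hs i hi.le, cphiSeries, coeff_mk, cphi]
  simp only [← ite_and]
  rw [Finset.sum_boole, Nat.cast_inj]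
  let f : ColoredFrobeniusPartition 6 n ≃ {p : Finset (ℕ × Fin 6) × Finset (ℕ × Fin 6) //
      (∑ x ∈ p.1, (1 + 1 * x.1) + ∑ x ∈ p.2, (0 + 1 * x.1) = n) ∧ p.1.card = p.2.card} :=
    { toFun := fun P => ⟨(P.top, P.bottom), by
        have := P.weight_eq
        simp only [Finset.sum_add_distrib, one_mul, zero_add, Finset.sum_const, smul_eq_mul,
          mul_one]
        exact this, P.card_eq⟩
      invFun := fun p => ⟨p.1.1, p.1.2, p.2.2, by
        have := p.2.1
        simp only [Finset.sum_add_distrib, one_mul, zero_add, Finset.sum_const, smul_eq_mul,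
          mul_one] at this
        exact this⟩
      left_inv := fun P => rfl
      right_inv := fun p => rfl }
  rw [Nat.card_congr f]
  refine Nat.subtype_card _ fun p => ?_
  rw [Finset.mem_filter]
  constructor
  · rintro ⟨_, h2, h3⟩
    exact ⟨by exact_mod_cast h2, by omega⟩
  · rintro ⟨h2, h3⟩
    have h4 : ((∑ x ∈ p.1, (1 + 1 * x.1) : ℕ) : ℤ) + (∑ x ∈ p.2, (0 + 1 * x.1) : ℕ) = n := by
      exact_mod_cast h2
    exact ⟨hs p h4.le, h4, by omega⟩

theorem cphiSeries_mul_euler_pow : cphiSeries * euler ℤ 1 ^ 6 =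
    expand 3 three_ne_zero (phi ℤ) * hexTheta ℤ ^ 2 + 2 * X * omega ℤ * hexCosetTheta ℤ ^ 2 := by
  rw [← constPart_theta_pow_six, ← jacobi_triple_product unitT (add_zero 1) le_rfl, mul_pow,
    cphiSeries_eq_constPart, ← constPart_mul_map, map_pow, map_euler _ le_rfl, euler]

end ConstantTerm

/-! ### Trisections of the theta series -/

section Trisections

variable {R : Type*} [CommRing R]

/-- The endomorphism `q ↦ q³`. -/
noncomputable def cubeVar (R : Type*) [CommRing R] : R⟦X⟧ →+* R⟦X⟧ :=
  (expand 3 three_ne_zero : R⟦X⟧ →ₐ[R] R⟦X⟧).toRingHom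

theorem cubeVar_apply (F : R⟦X⟧) : cubeVar R F = expand 3 three_ne_zero F := rfl

theorem cubeVar_X : cubeVar R X = X ^ 3 := expand_X 3 three_ne_zero

theorem map_cubeVar {S : Type*} [CommRing S] (f : R →+* S) (F : R⟦X⟧) :
    map f (cubeVar R F) = cubeVar S (map f F) := map_expand 3 three_ne_zero f F

theorem coeff_three_mul {F A B D : R⟦X⟧}
    (h : F = cubeVar R A + X * cubeVar R B + X ^ 2 * cubeVar R D) (n : ℕ) :
    coeff (3 * n) F = coeff n A := by
  have h1 : ¬ 3 ∣ 3 * n - 1 ∨ 3 * n = 0 := by omega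
  rw [h, map_add, map_add, cubeVar_apply, coeff_expand_mul, coeff_X_pow_mul', cubeVar_apply,
    cubeVar_apply, ← pow_one (X : R⟦X⟧), coeff_X_pow_mul', coeff_expand, coeff_expand]
  split_ifs <;> first | omega | simp

theorem coeff_three_mul_add_one {F A B D : R⟦X⟧}
    (h : F = cubeVar R A + X * cubeVar R B + X ^ 2 * cubeVar R D) (n : ℕ) :
    coeff (3 * n + 1) F = coeff n B := by
  rw [h, map_add, map_add, coeff_succ_X_mul, cubeVar_apply, cubeVar_apply, cubeVar_apply,
    coeff_expand_mul, coeff_X_pow_mul', coeff_expand, coeff_expand]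
  split_ifs <;> first | omega | simp

theorem coeff_three_mul_add_two {F A B D : R⟦X⟧}
    (h : F = cubeVar R A + X * cubeVar R B + X ^ 2 * cubeVar R D) (n : ℕ) :
    coeff (3 * n + 2) F = coeff n D := by
  rw [h, map_add, map_add, coeff_succ_X_mul, coeff_X_pow_mul, cubeVar_apply, cubeVar_apply,
    cubeVar_apply, coeff_expand_mul, coeff_expand, coeff_expand]
  split_ifs <;> first | omega | simp

theorem trisect_int_bijective : Function.Bijective
    (Sum.elim (fun t : ℤ => 3 * t) (Sum.elim (fun t => 3 * t - 1) (fun t => 1 - 3 * t))) :=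
  trisect_bijective
    (fun a b (h : 3 * a = 3 * b) => by omega) (fun a b (h : 3 * a - 1 = 3 * b - 1) => by omega)
    (fun a b (h : 1 - 3 * a = 1 - 3 * b) => by omega)
    (fun a b => by omega) (fun a b => by omega) (fun a b => by omega) (fun i => by
      have : i % 3 = 0 ∨ i % 3 = 1 ∨ i % 3 = 2 := by omega
      rcases this with h | h | h
      · exact Or.inl ⟨i / 3, by omega⟩
      · exact Or.inr (Or.inr ⟨-(i / 3), by omega⟩)
      · exact Or.inr (Or.inl ⟨(i + 1) / 3, by omega⟩))

theorem neg_one_zpow_three_mul (t : ℤ) : (-1 : Rˣ) ^ (3 * t) = (-1) ^ t := by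
  rw [zpow_mul]
  norm_num

theorem phi_trisect :
    phi R = cubeVar R (cubeVar R (phi R)) + 2 * X * cubeVar R (omega R) := by
  have h6 : Tame fun s => ((3 * 1 : ℕ) : ℤ) * tri s + (3 * 5 : ℕ) * tri (s - 1) :=
    tame_theta (by norm_num)
  simp only [cubeVar_apply, phi, omega, expand_theta]
  conv_lhs => rw [theta, qsum_trisect (tame_theta (by norm_num)) _ _ _ trisect_int_bijective]
  simp only [theta]
  rw [mul_assoc, X_mul_qsum _ h6, two_mul]
  congr 1
  · refine qsum_congr (fun t => by simp) fun t => ?_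
    push_cast
    linarith [two_mul_tri (3 * t), two_mul_tri (3 * t - 1), two_mul_tri t, two_mul_tri (t - 1)]
  congr 1
  · refine qsum_congr (fun t => by simp) fun t => ?_
    push_cast
    linarith [two_mul_tri (3 * t - 1), two_mul_tri (3 * t - 1 - 1), two_mul_tri t,
      two_mul_tri (t - 1)]
  · refine qsum_congr (fun t => by simp) fun t => ?_
    push_cast
    linarith [two_mul_tri (1 - 3 * t), two_mul_tri (1 - 3 * t - 1), two_mul_tri t,
      two_mul_tri (t - 1)]

theorem phi'_trisect :
    phi' R = cubeVar R (cubeVar R (phi' R)) - 2 * X ^ 2 * cubeVar R (omega' R) := by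
  have h6 : Tame fun s => ((3 * 2 : ℕ) : ℤ) * tri s + (3 * 10 : ℕ) * tri (s - 1) :=
    tame_theta (by norm_num)
  simp only [cubeVar_apply, phi', omega', expand_theta]
  conv_lhs => rw [theta, qsum_trisect (tame_theta (by norm_num)) _ _ _ trisect_int_bijective]
  simp only [theta]
  rw [sub_eq_add_neg, mul_assoc, X_pow_mul_qsum _ _ h6, two_mul, neg_add,
    neg_qsum _ (h6.add_const (by norm_num))]
  congr 1
  · refine qsum_congr (fun t => by rw [neg_one_zpow_three_mul]) fun t => ?_
    push_cast
    linarith [two_mul_tri (3 * t), two_mul_tri (3 * t - 1), two_mul_tri t, two_mul_tri (t - 1)]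
  congr 1
  · refine qsum_congr (fun t => ?_) fun t => ?_
    · rw [zpow_sub_one, neg_one_zpow_three_mul]
      simp
    · push_cast
      linarith [two_mul_tri (3 * t - 1), two_mul_tri (3 * t - 1 - 1), two_mul_tri t,
        two_mul_tri (t - 1)]
  · refine qsum_congr (fun t => ?_) fun t => ?_
    · rw [sub_eq_add_neg, zpow_add, zpow_one, zpow_neg, neg_one_zpow_three_mul, ← inv_zpow]
      simp
    · push_cast
      linarith [two_mul_tri (1 - 3 * t), two_mul_tri (1 - 3 * t - 1), two_mul_tri t,
        two_mul_tri (t - 1)]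

theorem psi'_trisect :
    ∃ B : R⟦X⟧, psi' R = cubeVar R B - X * cubeVar R (cubeVar R (psi' R)) := by
  have h9 : Tame fun s => ((3 * (3 * 1) : ℕ) : ℤ) * tri s + (3 * (3 * 3) : ℕ) * tri (s - 1) :=
    tame_theta (by norm_num)
  refine ⟨qsum (fun t : ℤ => (((-1) ^ t : Rˣ) : R)) (fun t => 6 * t ^ 2 - t) +
    qsum (fun t : ℤ => ((-(-1) ^ t : Rˣ) : R)) (fun t => 6 * t ^ 2 - 5 * t + 1), ?_⟩
  simp only [cubeVar_apply, psi', expand_theta, map_add, expand_qsum]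
  conv_lhs => rw [theta, qsum_trisect (tame_theta (by norm_num)) _ _ _ trisect_int_bijective,
    ← add_assoc]
  rw [sub_eq_add_neg]
  simp only [theta]
  rw [X_mul_qsum _ h9, neg_qsum _ (h9.add_const (by norm_num))]
  congr 1
  congr 1
  · refine qsum_congr (fun t => by rw [neg_one_zpow_three_mul]) fun t => ?_
    push_cast
    linarith [two_mul_tri (3 * t), two_mul_tri (3 * t - 1), two_mul_tri t, two_mul_tri (t - 1)]
  · refine qsum_congr (fun t => ?_) fun t => ?_
    · rw [zpow_sub_one, neg_one_zpow_three_mul]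
      simp
    · push_cast
      linarith [two_mul_tri (3 * t - 1), two_mul_tri (3 * t - 1 - 1), two_mul_tri t,
        two_mul_tri (t - 1)]
  · refine qsum_congr (fun t => ?_) fun t => ?_
    · rw [sub_eq_add_neg, zpow_add, zpow_one, zpow_neg, neg_one_zpow_three_mul, ← inv_zpow]
      simp
    · push_cast
      linarith [two_mul_tri (1 - 3 * t), two_mul_tri (1 - 3 * t - 1), two_mul_tri t,
        two_mul_tri (t - 1)]

end Trisections

/-! ### Congruences for the hexagonal theta series -/

theorem coeff_zero_hexTheta : coeff 0 (hexTheta ℤ) = 1 := by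
  rw [hexTheta, coeff_qsum _ _ 0 {(0, 0)}]
  · simp [hexNorm, Finset.filter_singleton]
  · rintro ⟨x, y⟩ h
    simp only [hexNorm, Nat.cast_zero] at h
    have hx : x = 0 := by nlinarith [sq_nonneg (x + y), sq_nonneg x, sq_nonneg y]
    have hy : y = 0 := by nlinarith [sq_nonneg (x + y), sq_nonneg x, sq_nonneg y]
    simp [hx, hy]

theorem isUnit_hexTheta : IsUnit (hexTheta ℤ) := by
  rw [isUnit_iff_constantCoeff, ← coeff_zero_eq_constantCoeff_apply, coeff_zero_hexTheta]
  exact isUnit_one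

/-- The quotient `E(q³)³ / E(q)`, a third of the theta series of a coset of the hexagonal lattice,
together with its rôle in the trisections of `a(q)` and `E(q)³`. -/
theorem exists_hexCosetTheta_div_three : ∃ g : ℤ⟦X⟧, g * euler ℤ 1 = euler ℤ 3 ^ 3 ∧
    hexCosetTheta ℤ = 3 * g ∧
    hexTheta ℤ = cubeVar ℤ (hexTheta ℤ) + 6 * X * cubeVar ℤ g ∧
    euler ℤ 1 ^ 3 = euler ℤ 3 * (cubeVar ℤ (hexTheta ℤ) - 3 * X * cubeVar ℤ g) := by
  obtain ⟨I, hI⟩ := (isUnit_euler (R := ℤ) (k := 1) le_rfl).exists_right_inv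
  have h1 : euler ℤ 3 ^ 3 * I * euler ℤ 1 = euler ℤ 3 ^ 3 := by
    linear_combination euler ℤ 3 ^ 3 * hI
  have h2 : hexCosetTheta ℤ = 3 * (euler ℤ 3 ^ 3 * I) := by
    linear_combination -hexCosetTheta ℤ * hI + I * hexCosetTheta_mul_euler
  generalize euler ℤ 3 ^ 3 * I = g at h1 h2
  refine ⟨g, h1, h2, ?_, ?_⟩
  · have h3 := hexTheta_trisect (R := ℤ)
    rw [h2, ← cubeVar_apply, ← cubeVar_apply, map_mul (cubeVar ℤ) 3, map_ofNat] at h3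
    linear_combination h3
  · have h3 := congrArg (cubeVar ℤ) h1
    rw [map_mul, map_pow, cubeVar_apply (euler ℤ 1), cubeVar_apply (euler ℤ 3), expand_euler,
      expand_euler] at h3
    norm_num at h3
    rw [euler_cube_eq, ← cubeVar_apply]
    linear_combination 3 * X * h3

theorem exists_hexTheta_eq_one_add : ∃ v : ℤ⟦X⟧, hexTheta ℤ = 1 + 3 * v := by
  obtain ⟨g, -, -, hg, -⟩ := exists_hexCosetTheta_div_three
  have key : ∀ n, n ≠ 0 → (3 : ℤ) ∣ coeff n (hexTheta ℤ) := by
    intro n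
    induction n using Nat.strong_induction_on with
    | _ n ih =>
      intro hn
      have h3 : (3 : ℤ) ∣ coeff n (6 * X * cubeVar ℤ g) := by
        rw [mul_assoc, show (6 : ℤ⟦X⟧) = C 6 from (map_ofNat C 6).symm, coeff_C_mul]
        exact Dvd.dvd.mul_right (by norm_num) _
      rw [hg, map_add]
      refine dvd_add ?_ h3
      rw [cubeVar_apply, coeff_expand]
      split_ifs with h
      · exact ih _ (Nat.div_lt_self (Nat.pos_of_ne_zero hn) (by norm_num)) (by omega)
      · exact dvd_zero _
  refine ⟨mk fun n => coeff n (hexTheta ℤ - 1) / 3, ?_⟩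
  ext n
  rw [map_add, show (3 : ℤ⟦X⟧) = C 3 from (map_ofNat C 3).symm, coeff_C_mul, coeff_mk,
    Int.mul_ediv_cancel', map_sub]
  · ring
  · rw [map_sub, coeff_one]
    split_ifs with h
    · rw [h, coeff_zero_hexTheta]; norm_num
    · simpa using key n h

/-! ### Trisection of the generating function modulo 243 -/

/-- The relations, over a ring in which `243 = 0`, from which the congruences follow by successive
trisections. Here `e` stands for `q ↦ q³`, and `x` for the variable `q`; `E`, `I` for `∏ (1 - qⁿ)`
and its inverse; `a`, `A` for `a(q)` and its inverse; `g` for `E(q³)³ / E(q)`; `p`, `w`, `p'`, `w'`, `s`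
for `φ(q)`, `Ω(q)`, `φ(-q²)`, `Ω(-q²)`, `ψ(-q)`; and `c` for the generating function of `cφ₆`. The
series `b` and `f`, whose values are irrelevant, appear only through `e`. -/
structure Relations {S : Type*} [CommRing S] (e : S →+* S) (x E I a A g p w p' w' s b f c : S) :
    Prop where
  zero : (243 : S) = 0
  e_x : e x = x ^ 3
  E_mul : E * I = 1
  a_mul : a * A = 1
  g_mul : g * E = e E ^ 3
  a_eq : a = e a + 6 * x * e g
  E_cube : E ^ 3 = e E * (e a - 3 * x * e g)
  a_congr : ∃ v, a = 1 + 3 * v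
  p_eq : p = e (e p) + 2 * x * e w
  p'_eq : p' = e (e p') - 2 * x ^ 2 * e w'
  s_eq : s = e b - x * e (e s)
  w_mul : w * E = p' * e s
  s_mul : s * w' = E * e f
  c_mul : c * E ^ 6 = e p * a ^ 2 + 18 * x * w * g ^ 2

namespace Relations

variable {S : Type*} [CommRing S] {e : S →+* S} {x E I a A g p w p' w' s b f c : S}

theorem E_mul' (h : Relations e x E I a A g p w p' w' s b f c) : e E * e I = 1 := by
  rw [← map_mul, h.E_mul, map_one]

theorem a_mul' (h : Relations e x E I a A g p w p' w' s b f c) : e a * e A = 1 := by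
  rw [← map_mul, h.a_mul, map_one]

/-- `1 / E(q)³` as a geometric series in `3 q e(g) / e(a)`, which ends since `3 ^ 5 = 0`. -/
theorem I_cube (h : Relations e x E I a A g p w p' w' s b f c) :
    I ^ 3 = e I * (e A * (1 + 3 * x * e g * e A + (3 * x * e g * e A) ^ 2 +
      (3 * x * e g * e A) ^ 3 + (3 * x * e g * e A) ^ 4)) := by
  have hI := h.E_mul
  have hI3 := h.E_mul'
  have hA3 := h.a_mul'
  have hE := h.E_cube
  have h0 := h.zero
  generalize e E = E3 at *
  generalize e I = I3 at *
  generalize e a = a3 at *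
  generalize e A = A3 at *
  rw [show 3 * x * e g = 3 * (x * e g) by ring] at hE ⊢
  generalize x * e g = y at *
  set N := A3 * (1 + 3 * y * A3 + (3 * y * A3) ^ 2 + (3 * y * A3) ^ 3 + (3 * y * A3) ^ 4) with hN
  have h1 : (a3 - 3 * y) * N = 1 := by
    rw [hN]
    linear_combination (1 + 3 * y * A3 + (3 * y * A3) ^ 2 + (3 * y * A3) ^ 3 + (3 * y * A3) ^ 4) *
      hA3 - (y * A3) ^ 5 * h0
  have h2 : E ^ 3 * (I3 * N) = 1 := by
    rw [hE]
    linear_combination (a3 - 3 * y) * N * hI3 + h1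
  have h3 : E ^ 3 * I ^ 3 = 1 := by rw [← mul_pow, hI, one_pow]
  linear_combination I3 * N * h3 - I ^ 3 * h2

/-- The part of degree `1 mod 3` of the generating function. -/
theorem trisect_c (h : Relations e x E I a A g p w p' w' s b f c) : ∃ P₀ P₂ : S,
    c = e P₀ + x * e (18 * (p * g * I ^ 2 * A + s * E ^ 3 * e p' * A ^ 3 -
      18 * x * s * E ^ 3 * w' * A ^ 4 * g)) + x ^ 2 * e P₂ := by
  refine ⟨p * I ^ 2 * (1 + 648 * x * g ^ 3 * A ^ 3) - 36 * x * w' * A ^ 3 * s * E ^ 3,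
    135 * p * I ^ 2 * g ^ 2 * A ^ 2 + 162 * s * E ^ 3 * g * A ^ 4 * e p', ?_⟩
  have h0 := h.zero
  have hI := h.E_mul
  have hI3 := h.E_mul'
  have hA3 := h.a_mul'
  have ha := h.a_eq
  have hp' := h.p'_eq
  have hw := h.w_mul
  have hg := h.g_mul
  have hc := h.c_mul
  have hIc := h.I_cube
  simp only [map_add, map_sub, map_mul, map_pow, map_ofNat, map_one, h.e_x]
  generalize e E = E3 at *
  generalize e I = I3 at *
  generalize e a = a3 at *
  generalize e A = A3 at *
  generalize e g = G at *
  set N := A3 * (1 + 3 * x * G * A3 + (3 * x * G * A3) ^ 2 + (3 * x * G * A3) ^ 3 +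
    (3 * x * G * A3) ^ 4) with hN
  have haN : a * N = 1 + 3 * (3 * x * G * A3) + 3 * (3 * x * G * A3) ^ 2 +
      3 * (3 * x * G * A3) ^ 3 + 3 * (3 * x * G * A3) ^ 4 := by
    rw [hN, ha]
    linear_combination (1 + 3 * x * G * A3 + (3 * x * G * A3) ^ 2 + (3 * x * G * A3) ^ 3 +
      (3 * x * G * A3) ^ 4) * hA3 + 2 * (x * G * A3) ^ 5 * h0
  have haN2 : (a * N) ^ 2 = 1 + 18 * x * G * A3 + 135 * (x * G * A3) ^ 2 +
      648 * (x * G * A3) ^ 3 := by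
    rw [haN]
    generalize hz : x * G * A3 = z
    rw [show 3 * x * G * A3 = 3 * z by rw [← hz]; ring,
      show 18 * x * G * A3 = 18 * z by rw [← hz]; ring]
    linear_combination (11 * z ^ 4 + 36 * z ^ 5 + 81 * z ^ 6 + 162 * z ^ 7 + 243 * z ^ 8) * h0
  have hN3 : 18 * N ^ 3 = 18 * (A3 ^ 3 + 9 * x * G * A3 ^ 4) := by
    rw [hN]
    generalize hz : x * G * A3 = z
    rw [show 3 * x * G * A3 = 3 * z by rw [← hz]; ring,
      show 9 * x * G * A3 ^ 4 = 9 * z * A3 ^ 3 by rw [← hz]; ring]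
    linear_combination (A3 ^ 3 * (4 * z ^ 2 + 20 * z ^ 3 + 90 * z ^ 4 + 324 * z ^ 5 + 1026 * z ^ 6 +
      2916 * z ^ 7 + 7290 * z ^ 8 + 14580 * z ^ 9 + 26244 * z ^ 10 + 39366 * z ^ 11 +
      39366 * z ^ 12)) * h0
  have hw2 : 18 * w * g ^ 2 * I ^ 6 = p' * e s * E3 ^ 3 * (18 * (A3 ^ 3 + 9 * x * G * A3 ^ 4)) := by
    have h1 : w = p' * e s * I := by linear_combination -w * hI + I * hw
    have h2 : g = E3 ^ 3 * I := by linear_combination -g * hI + I * hg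
    have h3 : E3 ^ 3 * I3 ^ 3 = 1 := by rw [← mul_pow, hI3, one_pow]
    rw [← hN3]
    calc 18 * w * g ^ 2 * I ^ 6 = 18 * p' * e s * E3 ^ 6 * (I ^ 3) ^ 3 := by rw [h1, h2]; ring
      _ = _ := by
        rw [hIc]
        linear_combination (18 * p' * e s * E3 ^ 3 * N ^ 3) * h3
  have hc2 : c = e p * I3 ^ 2 * (a * N) ^ 2 + x * (18 * w * g ^ 2 * I ^ 6) := by
    have h3 : E ^ 6 * I ^ 6 = 1 := by rw [← mul_pow, hI, one_pow]
    calc c = c * E ^ 6 * I ^ 6 := by linear_combination -c * h3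
      _ = e p * a ^ 2 * (I ^ 3) ^ 2 + x * (18 * w * g ^ 2 * I ^ 6) := by rw [hc]; ring
      _ = _ := by rw [hIc]; ring
  rw [hc2, haN2, hw2]
  linear_combination (x * e s * E3 ^ 3 * (18 * (A3 ^ 3 + 9 * x * G * A3 ^ 4))) * hp'

/-- The part of degree `2 mod 3` of the part of degree `1 mod 3` of the generating function. -/
theorem trisect_trisect_c (h : Relations e x E I a A g p w p' w' s b f c) : ∃ Q₀ Q₁ : S,
    18 * (p * g * I ^ 2 * A + s * E ^ 3 * e p' * A ^ 3 - 18 * x * s * E ^ 3 * w' * A ^ 4 * g) =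
      e Q₀ + x * e Q₁ + x ^ 2 * e (27 * (p' * e s * e E ^ 3)) := by
  have h0 := h.zero
  have hI := h.E_mul
  have hA := h.a_mul
  have hg := h.g_mul
  obtain ⟨v, hv⟩ := h.a_congr
  -- Powers of `a` and of `E³ / e E` may be dropped next to enough powers of `3`.
  have hA81 : 81 * A = 81 := by
    have h1 : 81 * a = 81 := by rw [hv]; linear_combination v * h0
    linear_combination 81 * hA - A * h1
  have hA27 : 27 * A ^ 3 = 27 := by
    have h1 : 27 * a ^ 3 = 27 := by
      rw [hv]; linear_combination (v + 3 * v ^ 2 + 3 * v ^ 3) * h0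
    have h2 : a ^ 3 * A ^ 3 = 1 := by rw [← mul_pow, hA, one_pow]
    linear_combination 27 * h2 - A ^ 3 * h1
  have hE81 : 81 * E ^ 3 = 81 * e E := by
    have h1 := congrArg e hv
    rw [map_add, map_mul, map_one, map_ofNat] at h1
    rw [h.E_cube, h1]
    linear_combination (e E * e v - e E * x * e g) * h0
  have hI3 := h.E_mul'
  have hA3 := h.a_mul'
  have ha := h.a_eq
  have hIc := h.I_cube
  have hEc := h.E_cube
  have hp := h.p_eq
  have hs := h.s_eq
  -- The part of degree `2 mod 3` consists of two terms, which turn out to be equal.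
  have hQ₂ : -(108 * w * E ^ 2 * g * A ^ 3) - 108 * e s * E * p' * g * A ^ 3 =
      27 * (p' * e s * e E ^ 3) := by
    linear_combination (-108 * E * g * A ^ 3) * h.w_mul - 216 * p' * e s * A ^ 3 * hg -
      8 * p' * e s * e E ^ 3 * hA27 - p' * e s * e E ^ 3 * h0
  -- The term with `w'` contributes to the degrees `1 mod 3` only.
  have hT₃ : 324 * x * s * E ^ 3 * w' * A ^ 4 * g = 324 * x * e E ^ 4 * e f := by
    linear_combination (324 * x * E ^ 3 * A ^ 4 * g) * h.s_mul +
      (324 * x * E ^ 3 * A ^ 4 * e f) * hg +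
      4 * x * E ^ 3 * e f * e E ^ 3 * (A ^ 3 + A ^ 2 + A + 1) * hA81 +
      4 * x * e f * e E ^ 3 * hE81
  refine ⟨18 * e p * E ^ 2 * A ^ 2 + 18 * b * E * p' * A ^ 2,
    36 * w * E ^ 2 * A ^ 2 - 54 * e p * E ^ 2 * g * A ^ 3 - 18 * e s * E * p' * A ^ 2 +
      108 * b * E * p' * g * A ^ 3 - 324 * E ^ 4 * f, ?_⟩
  rw [← hQ₂]
  simp only [map_add, map_sub, map_mul, map_pow, map_ofNat, map_neg]
  generalize e E = E3 at *
  generalize e I = I3 at *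
  generalize e a = a3 at *
  generalize e A = A3 at *
  generalize e g = G at *
  have hA18 : 18 * A = 18 * (A3 * (1 - 6 * x * G * A3 + 36 * (x * G * A3) ^ 2)) := by
    have h1 : 18 * (a * (A3 * (1 - 6 * x * G * A3 + 36 * (x * G * A3) ^ 2))) = 18 := by
      rw [ha]
      linear_combination 18 * (1 - 6 * x * G * A3 + 36 * (x * G * A3) ^ 2) * hA3 +
        16 * (x * G * A3) ^ 3 * h0
    linear_combination (-A) * h1 +
      18 * (A3 * (1 - 6 * x * G * A3 + 36 * (x * G * A3) ^ 2)) * hA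
  have hIA : 18 * (I ^ 3 * A) = 18 * (I3 * (A3 ^ 2 - 3 * x * G * A3 ^ 3)) := by
    calc 18 * (I ^ 3 * A) = I ^ 3 * (18 * A) := by ring
      _ = _ := by
        rw [hA18, hIc, show 3 * x * G * A3 = 3 * (x * G * A3) by ring,
          show 3 * x * G * A3 ^ 3 = 3 * (x * G * A3) * A3 ^ 2 by ring,
          show 6 * x * G * A3 = 6 * (x * G * A3) by ring]
        generalize x * G * A3 = z
        linear_combination (I3 * A3 ^ 2 * (2 * z ^ 2 + 6 * z ^ 3 + 18 * z ^ 4 + 36 * z ^ 5 +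
          216 * z ^ 6)) * h0
  have hEA : 18 * (E ^ 3 * A ^ 3) = 18 * (E3 * (A3 ^ 2 + 6 * x * G * A3 ^ 3)) := by
    set B := A3 * (1 - 6 * x * G * A3 + 36 * (x * G * A3) ^ 2) with hB
    have h1 : 18 * A ^ 3 = 18 * B ^ 3 := by
      linear_combination (A ^ 2 + A * B + B ^ 2) * hA18
    have h2 : (a3 - 3 * x * G) * B ^ 3 = A3 ^ 2 * (1 - 3 * (x * G * A3)) *
        (1 - 6 * (x * G * A3) + 36 * (x * G * A3) ^ 2) ^ 3 := by
      rw [hB]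
      linear_combination (A3 ^ 2 * (1 - 6 * (x * G * A3) + 36 * (x * G * A3) ^ 2) ^ 3) * hA3
    calc 18 * (E ^ 3 * A ^ 3) = E3 * (a3 - 3 * x * G) * (18 * A ^ 3) := by rw [hEc]; ring
      _ = 18 * E3 * ((a3 - 3 * x * G) * B ^ 3) := by rw [h1]; ring
      _ = _ := by
        rw [h2, show 6 * x * G * A3 ^ 3 = 6 * (x * G * A3) * A3 ^ 2 by ring]
        generalize x * G * A3 = z
        linear_combination (E3 * A3 ^ 2 * (-2 * z + 20 * z ^ 2 - 160 * z ^ 3 + 912 * z ^ 4 -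
          3456 * z ^ 5 + 8640 * z ^ 6 - 10368 * z ^ 7)) * h0
  have hT₁ : 18 * (p * g * I ^ 2 * A) =
      (e (e p) + 2 * x * e w) * E3 ^ 2 * (18 * (A3 ^ 2 - 3 * x * G * A3 ^ 3)) := by
    rw [← hp]
    linear_combination (-18 * p * g * I ^ 2 * A) * hI + (18 * p * I ^ 3 * A) * hg +
      (p * E3 ^ 3) * hIA + (18 * p * E3 ^ 2 * (A3 ^ 2 - 3 * x * G * A3 ^ 3)) * hI3
  have hT₂ : 18 * (s * E ^ 3 * e p' * A ^ 3) =
      (e b - x * e (e s)) * e p' * (18 * (E3 * (A3 ^ 2 + 6 * x * G * A3 ^ 3))) := by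
    rw [← hs]
    linear_combination (s * e p') * hEA
  linear_combination hT₁ + hT₂ - hT₃

theorem trisect_w (h : Relations e x E I a A g p w p' w' s b f c) :
    p' * e s * e E ^ 3 = e (E ^ 3 * s * e p') + x * e 0 + x ^ 2 * e (-2 * E ^ 3 * s * w') := by
  conv_lhs => rw [h.p'_eq]
  simp only [map_mul, map_pow, map_zero, map_neg, map_ofNat]
  ring

theorem trisect_trisect_w (h : Relations e x E I a A g p w p' w' s b f c) : ∃ W₀ W₁ : S,
    E ^ 3 * s * e p' = e W₀ + x * e W₁ + x ^ 2 * e (3 * (p' * e s * e E ^ 3)) := by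
  refine ⟨E * a * b * p', -(E * a * e s * p') - 3 * g * E * b * p', ?_⟩
  have hg := congrArg e h.g_mul
  conv_lhs => rw [h.E_cube, h.s_eq]
  simp only [map_mul, map_pow, map_sub, map_neg, map_ofNat] at hg ⊢
  linear_combination 3 * x ^ 2 * e (e s) * e p' * hg

end Relations

/-! ### The congruences -/

/-- Reduction modulo 243 of the coefficients. -/
noncomputable abbrev mod243 : ℤ⟦X⟧ →+* (ZMod 243)⟦X⟧ := map (Int.castRingHom (ZMod 243))

theorem exists_relations : ∃ E I a A g p w p' w' s b f : (ZMod 243)⟦X⟧,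
    Relations (cubeVar (ZMod 243)) X E I a A g p w p' w' s b f (mod243 cphiSeries) := by
  obtain ⟨g, hg, hg3, ha, hE⟩ := exists_hexCosetTheta_div_three
  obtain ⟨I, hI⟩ := (isUnit_euler (R := ℤ) (k := 1) le_rfl).exists_right_inv
  obtain ⟨A, hA⟩ := isUnit_hexTheta.exists_right_inv
  obtain ⟨v, hv⟩ := exists_hexTheta_eq_one_add
  obtain ⟨b, hb⟩ := psi'_trisect (R := ZMod 243)
  obtain ⟨f, hf⟩ := psi'_mul_omega' (R := ZMod 243)
  have hE3 : cubeVar (ZMod 243) (mod243 (euler ℤ 1)) = mod243 (euler ℤ 3) := by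
    rw [← map_cubeVar, cubeVar_apply, expand_euler]
  have hE1 : mod243 (euler ℤ 1) = euler (ZMod 243) 1 := map_euler _ le_rfl
  refine ⟨mod243 (euler ℤ 1), mod243 I, mod243 (hexTheta ℤ), mod243 A, mod243 g, phi _, omega _,
    phi' _, omega' _, psi' _, b, f, ?_⟩
  constructor
  · have h : (243 : ZMod 243) = 0 := by decide
    rw [show (243 : (ZMod 243)⟦X⟧) = C 243 from (map_ofNat C 243).symm, h, map_zero]
  · exact cubeVar_X
  · rw [← map_mul, hI, map_one]
  · rw [← map_mul, hA, map_one]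
  · rw [← map_mul, hg, hE3, map_pow]
  · conv_lhs => rw [ha]
    rw [map_add, map_mul, map_mul, map_cubeVar, map_cubeVar, map_X, map_ofNat]
  · rw [← map_pow, hE, map_mul, map_sub, map_mul, map_mul, map_cubeVar, map_cubeVar, map_X,
      map_ofNat, hE3]
  · exact ⟨mod243 v, by rw [hv, map_add, map_mul, map_one, map_ofNat]⟩
  · exact phi_trisect
  · exact phi'_trisect
  · exact hb
  · rw [hE1, omega_mul_euler, cubeVar_apply, expand_theta]
  · rw [hE1]
    exact hf
  · have h := congrArg mod243 cphiSeries_mul_euler_pow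
    rw [hg3, ← cubeVar_apply] at h
    simp only [map_add, map_mul, map_pow, map_ofNat, map_cubeVar, map_X] at h
    have hp : mod243 (phi ℤ) = phi (ZMod 243) := by
      rw [phi, map_theta _ _ (by norm_num), map_one]
    have hw : mod243 (omega ℤ) = omega (ZMod 243) := by
      rw [omega, map_theta _ _ (by norm_num), map_one]
    rw [hp, hw] at h
    rw [h]
    ring

/-- All the congruences are governed by a single sequence `w`, with
`∑ w(n) qⁿ = φ(-q²) ψ(-q³) E(q³)³`. -/
theorem exists_cphi_eq : ∃ w : ℕ → ZMod 243, (∀ n, (cphi 6 (9 * n + 7) : ZMod 243) = 27 * w n) ∧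
    (∀ n, w (3 * n + 1) = 0) ∧ (∀ n, w (9 * n + 6) = 3 * w n) := by
  obtain ⟨E, I, a, A, g, p, w, p', w', s, b, f, h⟩ := exists_relations
  set W := p' * cubeVar _ s * cubeVar _ E ^ 3 with hW
  obtain ⟨P₀, P₂, hP⟩ := h.trisect_c
  obtain ⟨Q₀, Q₁, hQ⟩ := h.trisect_trisect_c
  obtain ⟨W₀, W₁, hW₀⟩ := h.trisect_trisect_w
  rw [← hW] at hQ hW₀
  refine ⟨fun n => coeff n W, fun n => ?_, fun n => ?_, fun n => ?_⟩
  · have h1 : (cphi 6 (9 * n + 7) : ZMod 243) =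
        coeff (3 * (3 * n + 2) + 1) (mod243 cphiSeries) := by
      rw [coeff_map, cphiSeries, coeff_mk, show 3 * (3 * n + 2) + 1 = 9 * n + 7 by ring]
      simp
    rw [h1, coeff_three_mul_add_one hP, coeff_three_mul_add_two hQ,
      show (27 : (ZMod 243)⟦X⟧) = C 27 from (map_ofNat C 27).symm, coeff_C_mul]
  · exact (coeff_three_mul_add_one h.trisect_w n).trans (map_zero _)
  · have h1 := coeff_three_mul h.trisect_w (3 * n + 2)
    rw [coeff_three_mul_add_two hW₀, show (3 : (ZMod 243)⟦X⟧) = C 3 from (map_ofNat C 3).symm,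
      coeff_C_mul] at h1
    rw [← h1, hW, show 9 * n + 6 = 3 * (3 * n + 2) by ring]

end Theta

theorem theorem1 (n : ℕ) :
    cphi 6 (27 * n + 16) ≡ 0 [MOD 243] ∧
    cphi 6 (81 * n + 61) ≡ 0 [MOD 81] ∧
    cphi 6 (243 * n + 142) ≡ 0 [MOD 243] ∧
    cphi 6 (729 * n + 547) ≡ 0 [MOD 243] ∧
    cphi 6 (81 * n + 61) ≡ 3 * cphi 6 (9 * n + 7) [MOD 243] := by
  obtain ⟨w, h, h1, h6⟩ := Theta.exists_cphi_eq
  have h61 : ∀ n, (cphi 6 (81 * n + 61) : ZMod 243) = 81 * w n := fun n => by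
    rw [show 81 * n + 61 = 9 * (9 * n + 6) + 7 by ring, h, h6]
    ring
  have h243 : (243 : ZMod 243) = 0 := by decide
  refine ⟨?_, ?_, ?_, ?_, ?_⟩
  · rw [← ZMod.natCast_eq_natCast_iff, show 27 * n + 16 = 9 * (3 * n + 1) + 7 by ring, h, h1]
    simp
  · have h2 : cphi 6 (81 * n + 61) ≡ 81 * (w n).val [MOD 243] := by
      rw [← ZMod.natCast_eq_natCast_iff, h61]
      simp
    exact (h2.of_dvd (by norm_num)).trans (Nat.modEq_zero_iff_dvd.2 (dvd_mul_right _ _))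
  · rw [← ZMod.natCast_eq_natCast_iff, show 243 * n + 142 = 81 * (3 * n + 1) + 61 by ring, h61, h1]
    simp
  · rw [← ZMod.natCast_eq_natCast_iff, show 729 * n + 547 = 81 * (9 * n + 6) + 61 by ring, h61, h6]
    push_cast
    linear_combination w n * h243
  · rw [← ZMod.natCast_eq_natCast_iff, h61]
    push_cast
    rw [h]
    ring
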